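/- Let $K$ be an algebraically closed field of characteristic $p>3$, and let $W$ be the $p$-dimensional Witt algebra over $K$ with basis $e_{-1},e_0,\dots,e_{p-2}$, bracket $[e_i,e_j]=(j-i)e_{i+j}$ (where $e_i=0$ for $i\notin\{-1,\dots,p-2\}$) and $p$-mapping determined by $e_i^{[p]}=\delta_{i0}e_i$. For $-1\le i\le p-1$ put $W_i=Ke_i\oplus\cdots\oplus Ke_{p-2}$ (so $W_{p-1}=0$), and for $\chi\in W^*$ let the height of $\chi$ be $r(\chi)=\min\{i\mid -1\le i\le p-1,\ \chi|_{W_i}=0\}$. For a restricted subalgebra $L\subseteq W$ let $U_\chi(L)$ be the quotient of the universal enveloping algebra $U(L)$ by the ideal generated by all $x^p-x^{[p]}-\chi(x)^p$ with $x\in L$. Let $\chi\in W^*$ have height $-1$, $0$ or $1$, and let $\lambda\in\Lambda(\chi)=\{\lambda\in K\mid\lambda^p-\lambda=\chi(e_0)^p\}$. Let $K_\lambda$ be $K$ regarded as the $U_\chi(W_0)$-module on which $e_0$ acts as $\lambda$ and $e_i$ acts as $0$ for $1\le i\le p-2$, and let $V_\chi(\lambda)=U_\chi(W)\otimes_{U_\chi(W_0)}K_\lambda$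 be the reduced Verma module, regarded as a $U_\chi(W_0)$-module by restriction. Then, as $K$-vector spaces, $$\operatorname{Ext}^1_{U_\chi(W_0)}(K_\lambda,V_\chi(\lambda))\simeq\begin{cases}K,&\text{if }\lambda\in\{0,p-1\},\\ 0,&\text{otherwise,}\end{cases}$$ where $0$ and $p-1$ are viewed as elements of the prime field of $K$. In particular, if $\chi$ has height $1$, then $\operatorname{Ext}^1_{U_\chi(W_0)}(K_\lambda,V_\chi(\lambda))=0$. -/

import Mathlib

open CategoryTheory
open scoped TensorProduct

universe u

noncomputable section

/-- The `p`-dimensional space underlying the Witt algebra, given by coordinates: the function `f`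
stands for `∑ a, f a • e_{a-1}`. Equivalently, with `e_{a-1} = x ^ a ∂`, for the derivation
`(∑ a, f a x ^ a) ∂` of the truncated polynomial ring `K[x] / (x ^ p)`. -/
def WittAlgebra (K : Type u) (p : ℕ) : Type u := Fin p → K

namespace WittAlgebra

variable (K : Type u) [Field K] (p : ℕ)

instance : AddCommGroup (WittAlgebra K p) := inferInstanceAs (AddCommGroup (Fin p → K))

instance : Module K (WittAlgebra K p) := inferInstanceAs (Module K (Fin p → K))

/-- The basis vector `e_i` for `-1 ≤ i ≤ p - 2`; it is zero for every other integer `i`. -/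
def e (i : ℤ) : WittAlgebra K p := fun c => if (c : ℤ) = i + 1 then 1 else 0

/-- `der f g = f g'` in `K[x] / (x ^ p)`, both arguments being read as truncated polynomials.
So `der f` is the action of `f` on `K[x] / (x ^ p)` as the derivation `f ∂`. -/
def der : WittAlgebra K p →ₗ[K] WittAlgebra K p →ₗ[K] WittAlgebra K p :=
  LinearMap.mk₂ K
    (fun f g c => ∑ a : Fin p, ∑ b : Fin p,
      if (a : ℕ) + (b : ℕ) = (c : ℕ) + 1 then ((b : ℕ) : K) * f a * g b else 0)
    (fun f f' g => by
      funext c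
      change (∑ a : Fin p, ∑ b : Fin p,
        if (a : ℕ) + (b : ℕ) = (c : ℕ) + 1 then ((b : ℕ) : K) * (f a + f' a) * g b else (0 : K)) =
        (∑ a : Fin p, ∑ b : Fin p,
        if (a : ℕ) + (b : ℕ) = (c : ℕ) + 1 then ((b : ℕ) : K) * f a * g b else (0 : K)) +
        (∑ a : Fin p, ∑ b : Fin p,
        if (a : ℕ) + (b : ℕ) = (c : ℕ) + 1 then ((b : ℕ) : K) * f' a * g b else (0 : K))
      simp only [← Finset.sum_add_distrib]
      refine Finset.sum_congr rfl fun a _ => Finset.sum_congr rfl fun b _ => ?_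
      split_ifs <;> ring)
    (fun r f g => by
      funext c
      change (∑ a : Fin p, ∑ b : Fin p,
        if (a : ℕ) + (b : ℕ) = (c : ℕ) + 1 then ((b : ℕ) : K) * (r * f a) * g b else (0 : K)) = r *
        (∑ a : Fin p, ∑ b : Fin p,
        if (a : ℕ) + (b : ℕ) = (c : ℕ) + 1 then ((b : ℕ) : K) * f a * g b else (0 : K))
      simp only [Finset.mul_sum]
      refine Finset.sum_congr rfl fun a _ => Finset.sum_congr rfl fun b _ => ?_
      split_ifs <;> ring)
    (fun f g g' => by
      funext c
      change (∑ a : Fin p, ∑ b : Fin p,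
        if (a : ℕ) + (b : ℕ) = (c : ℕ) + 1 then ((b : ℕ) : K) * f a * (g b + g' b) else (0 : K)) =
        (∑ a : Fin p, ∑ b : Fin p,
        if (a : ℕ) + (b : ℕ) = (c : ℕ) + 1 then ((b : ℕ) : K) * f a * g b else (0 : K)) +
        (∑ a : Fin p, ∑ b : Fin p,
        if (a : ℕ) + (b : ℕ) = (c : ℕ) + 1 then ((b : ℕ) : K) * f a * g' b else (0 : K))
      simp only [← Finset.sum_add_distrib]
      refine Finset.sum_congr rfl fun a _ => Finset.sum_congr rfl fun b _ => ?_
      split_ifs <;> ring)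
    (fun r f g => by
      funext c
      change (∑ a : Fin p, ∑ b : Fin p,
        if (a : ℕ) + (b : ℕ) = (c : ℕ) + 1 then ((b : ℕ) : K) * f a * (r * g b) else (0 : K)) = r *
        (∑ a : Fin p, ∑ b : Fin p,
        if (a : ℕ) + (b : ℕ) = (c : ℕ) + 1 then ((b : ℕ) : K) * f a * g b else (0 : K))
      simp only [Finset.mul_sum]
      refine Finset.sum_congr rfl fun a _ => Finset.sum_congr rfl fun b _ => ?_
      split_ifs <;> ring)

variable {K p}

theorem der_apply (f g : WittAlgebra K p) (c : Fin p) :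
    der K p f g c = ∑ a : Fin p, ∑ b : Fin p,
      if (a : ℕ) + (b : ℕ) = (c : ℕ) + 1 then ((b : ℕ) : K) * f a * g b else 0 := rfl

theorem e_apply (i : ℤ) (c : Fin p) : e K p i c = if (c : ℤ) = i + 1 then 1 else 0 := rfl

theorem eq_sum_e (f : WittAlgebra K p) : f = ∑ a : Fin p, f a • e K p ((a : ℤ) - 1) := by
  have h := pi_eq_sum_univ (ι := Fin p) (R := K) f
  refine h.trans (Finset.sum_congr rfl fun a _ => ?_)
  congr 1
  funext c
  rw [e_apply]
  refine if_congr ?_ rfl rfl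
  rw [Fin.ext_iff]
  omega

theorem e_induction {P : WittAlgebra K p → Prop} (f : WittAlgebra K p) (h0 : P 0)
    (hadd : ∀ x y, P x → P y → P (x + y)) (hsmul : ∀ (r : K) x, P x → P (r • x))
    (he : ∀ n : ℕ, P (e K p ((n : ℤ) - 1))) : P f := by
  rw [eq_sum_e f]
  exact Finset.sum_induction _ P hadd h0 fun a _ => hsmul _ _ (he _)

theorem der_e [CharP K p] (m n : ℕ) :
    der K p (e K p ((m : ℤ) - 1)) (e K p ((n : ℤ) - 1)) =
      (n : K) • e K p (((m + n - 1 : ℕ) : ℤ) - 1) := by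
  funext c
  change _ = (n : K) * e K p (((m + n - 1 : ℕ) : ℤ) - 1) c
  rw [der_apply, e_apply]
  have hc := c.isLt
  by_cases hm : m < p
  · rw [Finset.sum_eq_single (⟨m, hm⟩ : Fin p)]
    · by_cases hn : n < p
      · rw [Finset.sum_eq_single (⟨n, hn⟩ : Fin p)]
        · simp only [e_apply]
          rcases Nat.eq_zero_or_pos n with rfl | hn0
          · simp
          · have : (m + n = (c : ℕ) + 1) ↔ ((c : ℤ) = ((m + n - 1 : ℕ) : ℤ) - 1 + 1) := by omega
            by_cases h : m + n = (c : ℕ) + 1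
            · rw [if_pos h, if_pos (this.1 h)]; simp
            · rw [if_neg h, if_neg (fun h' => h (this.2 h'))]; simp
        · intro b _ hb
          have : ¬ ((b : ℤ) = (n : ℤ) - 1 + 1) := by
            intro h; apply hb; apply Fin.ext; simp only; omega
          simp only [e_apply, if_neg this, mul_zero, ite_self]
        · simp
      · rw [Finset.sum_eq_zero]
        · by_cases hnp : n = p
          · subst hnp; simp
          · rw [if_neg (by omega), mul_zero]
        · intro b _
          have : ¬ ((b : ℤ) = (n : ℤ) - 1 + 1) := by have := b.isLt; omega
          simp only [e_apply, if_neg this, mul_zero, ite_self]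
    · intro a _ ha
      have : ¬ ((a : ℤ) = (m : ℤ) - 1 + 1) := by
        intro h; apply ha; apply Fin.ext; simp only; omega
      simp only [e_apply, if_neg this, mul_zero, zero_mul, ite_self, Finset.sum_const_zero]
    · simp
  · rw [Finset.sum_eq_zero]
    · rcases Nat.eq_zero_or_pos n with rfl | hn0
      · simp
      · rw [if_neg (by omega), mul_zero]
    · intro a _
      have : ¬ ((a : ℤ) = (m : ℤ) - 1 + 1) := by have := a.isLt; omega
      simp only [e_apply, if_neg this, mul_zero, zero_mul, ite_self, Finset.sum_const_zero]

/-- The Lie bracket `[f, g] = f g' - g f'`, that is, the commutator of the derivations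
`f ∂` and `g ∂`. -/
instance : Bracket (WittAlgebra K p) (WittAlgebra K p) := ⟨fun f g => der K p f g - der K p g f⟩

theorem lie_def (f g : WittAlgebra K p) : ⁅f, g⁆ = der K p f g - der K p g f := rfl

theorem lie_e_nat [CharP K p] (m n : ℕ) :
    ⁅e K p ((m : ℤ) - 1), e K p ((n : ℤ) - 1)⁆ =
      ((n : K) - (m : K)) • e K p (((m + n - 1 : ℕ) : ℤ) - 1) := by
  rw [lie_def, der_e, der_e, add_comm n m, sub_smul]

theorem jacobi_e [CharP K p] (a b c : ℕ) :
    ⁅e K p ((a : ℤ) - 1), ⁅e K p ((b : ℤ) - 1), e K p ((c : ℤ) - 1)⁆⁆ =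
      ⁅⁅e K p ((a : ℤ) - 1), e K p ((b : ℤ) - 1)⁆, e K p ((c : ℤ) - 1)⁆ +
      ⁅e K p ((b : ℤ) - 1), ⁅e K p ((a : ℤ) - 1), e K p ((c : ℤ) - 1)⁆⁆ := by
  have hl : ∀ (r : K) (x y : WittAlgebra K p), ⁅r • x, y⁆ = r • ⁅x, y⁆ := fun r x y => by
    simp [lie_def, smul_sub]
  have hr : ∀ (r : K) (x y : WittAlgebra K p), ⁅x, r • y⁆ = r • ⁅x, y⁆ := fun r x y => by
    simp [lie_def, smul_sub]
  rw [lie_e_nat b c, lie_e_nat a b, lie_e_nat a c, hr, hl, hr, lie_e_nat, lie_e_nat, lie_e_nat,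
    smul_smul, smul_smul, smul_smul]
  by_cases h1 : a + b = 0
  · obtain ⟨rfl, rfl⟩ : a = 0 ∧ b = 0 := by omega
    simp
  by_cases h2 : b + c = 0
  · obtain ⟨rfl, rfl⟩ : b = 0 ∧ c = 0 := by omega
    simp only [Nat.add_zero, Nat.zero_add, ← add_smul, sub_self, zero_mul, zero_smul]
    rw [show ∀ t : K, (0 : WittAlgebra K p) = (0 : K) • e K p (((a - 1 - 1 : ℕ) : ℤ) - 1) from
      fun _ => (zero_smul _ _).symm]
    · congr 1
      ring
    · exact 0
  by_cases h3 : a + c = 0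
  · obtain ⟨rfl, rfl⟩ : a = 0 ∧ c = 0 := by omega
    simp only [Nat.zero_add, sub_self, zero_mul, zero_smul, add_zero]
    congr 1
    ring
  · rw [show a + (b + c - 1) - 1 = a + b + c - 2 by omega,
      show a + b - 1 + c - 1 = a + b + c - 2 by omega,
      show b + (a + c - 1) - 1 = a + b + c - 2 by omega, ← add_smul]
    congr 1
    rw [Nat.cast_sub (by omega), Nat.cast_sub (by omega), Nat.cast_sub (by omega)]
    push_cast
    ring

instance [CharP K p] : LieRing (WittAlgebra K p) where
  add_lie x y z := by simp only [lie_def, map_add, LinearMap.add_apply]; abel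
  lie_add x y z := by simp only [lie_def, map_add, LinearMap.add_apply]; abel
  lie_self x := by simp [lie_def]
  leibniz_lie x y z := by
    have hz : ∀ x y z : WittAlgebra K p, ⁅x, y + z⁆ = ⁅x, y⁆ + ⁅x, z⁆ := fun x y z => by
      simp only [lie_def, map_add, LinearMap.add_apply]; abel
    have hz' : ∀ x y z : WittAlgebra K p, ⁅x + y, z⁆ = ⁅x, z⁆ + ⁅y, z⁆ := fun x y z => by
      simp only [lie_def, map_add, LinearMap.add_apply]; abel
    have hl : ∀ (r : K) (x y : WittAlgebra K p), ⁅r • x, y⁆ = r • ⁅x, y⁆ := fun r x y => by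
      simp [lie_def, smul_sub]
    have hr : ∀ (r : K) (x y : WittAlgebra K p), ⁅x, r • y⁆ = r • ⁅x, y⁆ := fun r x y => by
      simp [lie_def, smul_sub]
    have h0 : ∀ x : WittAlgebra K p, ⁅x, (0 : WittAlgebra K p)⁆ = 0 := fun x => by simp [lie_def]
    have h0' : ∀ x : WittAlgebra K p, ⁅(0 : WittAlgebra K p), x⁆ = 0 := fun x => by simp [lie_def]
    induction x using e_induction with
    | h0 => simp only [h0, h0', add_zero]
    | hadd x x' hx hx' => simp only [hz, hz', hx, hx']; abel
    | hsmul r x hx => simp only [hl, hr, hx, smul_add]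
    | he a =>
      induction y using e_induction with
      | h0 => simp only [h0, h0', add_zero]
      | hadd x x' hx hx' => simp only [hz, hz', hx, hx']; abel
      | hsmul r x hx => simp only [hl, hr, hx, smul_add]
      | he b =>
        induction z using e_induction with
        | h0 => simp only [h0, add_zero]
        | hadd x x' hx hx' => simp only [hz, hx, hx']; abel
        | hsmul r x hx => simp only [hr, hx, smul_add]
        | he c => exact jacobi_e a b c

instance [CharP K p] : LieAlgebra K (WittAlgebra K p) where
  lie_smul r x y := by simp [lie_def, smul_sub]

/-- The defining relations `[e_i, e_j] = (j - i) e_{i+j}` of the Witt algebra. -/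
theorem lie_e [CharP K p] (i j : ℤ) (hi : -1 ≤ i) (hj : -1 ≤ j) :
    ⁅e K p i, e K p j⁆ = ((j : K) - (i : K)) • e K p (i + j) := by
  obtain ⟨m, rfl⟩ : ∃ m : ℕ, i = (m : ℤ) - 1 := ⟨(i + 1).toNat, by omega⟩
  obtain ⟨n, rfl⟩ : ∃ n : ℕ, j = (n : ℤ) - 1 := ⟨(j + 1).toNat, by omega⟩
  rw [lie_e_nat]
  by_cases h : m + n = 0
  · obtain ⟨rfl, rfl⟩ : m = 0 ∧ n = 0 := by omega
    simp
  · rw [show (((m + n - 1 : ℕ) : ℤ) - 1) = (m : ℤ) - 1 + ((n : ℤ) - 1) by omega]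
    congr 1
    push_cast
    ring

variable (K p) in
/-- The `p`-mapping `f ↦ f^[p]`. The `p`-th power of the derivation `D = f ∂` of `K[x] / (x ^ p)`
is again a derivation, hence equal to `D ^ p (x) ∂`; and `x` is the polynomial of `e_0`. -/
def pMap (f : WittAlgebra K p) : WittAlgebra K p := ((der K p f) ^ p) (e K p 0)

/-- The values `e_i^[p] = δ_{i0} e_i` of the `p`-mapping on the basis. -/
theorem pMap_e [CharP K p] (hp : 3 < p) (i : ℤ) (hi : -1 ≤ i) (hi' : i ≤ (p : ℤ) - 2) :
    pMap K p (e K p i) = if i = 0 then e K p i else 0 := by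
  obtain ⟨m, rfl⟩ : ∃ m : ℕ, i = (m : ℤ) - 1 := ⟨(i + 1).toNat, by omega⟩
  have h0 : e K p 0 = e K p (((1 : ℕ) : ℤ) - 1) := by simp
  rw [pMap, h0]
  rcases (by omega : m = 1 ∨ m = 0 ∨ 2 ≤ m) with rfl | rfl | hm
  · have h1 : der K p (e K p (((1 : ℕ) : ℤ) - 1)) (e K p (((1 : ℕ) : ℤ) - 1)) =
        e K p (((1 : ℕ) : ℤ) - 1) := by rw [der_e]; simp
    have h2 : ∀ n : ℕ, ((der K p (e K p (((1 : ℕ) : ℤ) - 1))) ^ n) (e K p (((1 : ℕ) : ℤ) - 1)) =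
        e K p (((1 : ℕ) : ℤ) - 1) := fun n => by
      induction n with
      | zero => simp
      | succ n ih => rw [pow_succ', Module.End.mul_apply, ih, h1]
    rw [h2]; simp
  · obtain ⟨q, rfl⟩ : ∃ q, p = q + 2 := ⟨p - 2, by omega⟩
    rw [pow_add, Module.End.mul_apply, pow_two, Module.End.mul_apply, der_e, map_smul, der_e]
    simp
  · have h2 : ∀ n : ℕ, ∃ r : K, ((der K p (e K p ((m : ℤ) - 1))) ^ n)
        (e K p (((1 : ℕ) : ℤ) - 1)) = r • e K p (((1 + n * (m - 1) : ℕ) : ℤ) - 1) := fun n => by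
      induction n with
      | zero => exact ⟨1, by simp⟩
      | succ n ih =>
        obtain ⟨r, hr⟩ := ih
        rw [pow_succ', Module.End.mul_apply, hr, map_smul, der_e, smul_smul]
        refine ⟨r * ((1 + n * (m - 1) : ℕ) : K), ?_⟩
        rw [show m + (1 + n * (m - 1)) - 1 = 1 + (n + 1) * (m - 1) by rw [Nat.succ_mul]; omega]
    obtain ⟨r, hr⟩ := h2 p
    rw [hr, if_neg (by omega)]
    have : e K p (((1 + p * (m - 1) : ℕ) : ℤ) - 1) = 0 := by
      funext c
      rw [e_apply, if_neg]
      · rfl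
      have := c.isLt
      have : p * 1 ≤ p * (m - 1) := Nat.mul_le_mul_left p (by omega)
      omega
    rw [this, smul_zero]

variable (K p) in
/-- The subspace `W_i = K e_i ⊕ ⋯ ⊕ K e_{p-2}`. -/
def filt (i : ℤ) : Submodule K (WittAlgebra K p) :=
  Submodule.span K {x | ∃ j : ℤ, i ≤ j ∧ j ≤ (p : ℤ) - 2 ∧ x = e K p j}

/-- The height of a linear form `χ`: the least `i` with `-1 ≤ i ≤ p - 1` such that `χ` vanishes
on `W_i`. -/
def height (χ : Module.Dual K (WittAlgebra K p)) : ℤ :=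
  sInf {i : ℤ | -1 ≤ i ∧ i ≤ (p : ℤ) - 1 ∧ ∀ x ∈ filt K p i, χ x = 0}

/-- The set `Λ(χ)` of weights of `χ`. -/
def weights (χ : Module.Dual K (WittAlgebra K p)) : Set K :=
  {l | l ^ p - l = χ (e K p 0) ^ p}

theorem mem_filt_iff (i : ℤ) (f : WittAlgebra K p) :
    f ∈ filt K p i ↔ ∀ a : Fin p, (a : ℤ) < i + 1 → f a = 0 := by
  constructor
  · intro hf
    induction hf using Submodule.span_induction with
    | mem x hx =>
      obtain ⟨j, h1, h2, rfl⟩ := hx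
      intro a ha
      rw [e_apply, if_neg (by omega)]
    | zero => intro a _; rfl
    | add x y _ _ hx hy => 
      intro a ha
      change x a + y a = 0
      rw [hx a ha, hy a ha, add_zero]
    | smul r x _ hx =>
      intro a ha
      change r * x a = 0
      rw [hx a ha, mul_zero]
  · intro h
    rw [eq_sum_e f]
    refine Submodule.sum_mem _ fun a _ => ?_
    by_cases ha : (a : ℤ) < i + 1
    · rw [h a ha, zero_smul]; exact Submodule.zero_mem _
    · have := a.isLt
      exact Submodule.smul_mem _ _ (Submodule.subset_span ⟨_, by omega, by omega, rfl⟩)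

theorem der_mem {f g : WittAlgebra K p} (hf : f ∈ filt K p 0) (hg : g ∈ filt K p 0) :
    der K p f g ∈ filt K p 0 := by
  rw [mem_filt_iff] at hf hg ⊢
  intro c hc
  rw [der_apply]
  refine Finset.sum_eq_zero fun a _ => Finset.sum_eq_zero fun b _ => ?_
  split_ifs with h
  · by_cases ha : (a : ℕ) = 0
    · rw [hf a (by omega)]; ring
    · rw [hg b (by omega)]; ring
  · rfl

variable (K p) in
/-- The Lie subalgebra `W_0`. -/
def W0 [CharP K p] : LieSubalgebra K (WittAlgebra K p) where
  __ := filt K p 0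
  lie_mem' hf hg := Submodule.sub_mem _ (der_mem hf hg) (der_mem hg hf)

theorem pMap_mem [Fact p.Prime] {f : WittAlgebra K p} (hf : f ∈ filt K p 0) :
    pMap K p f ∈ filt K p 0 := by
  have hp : 2 ≤ p := (Fact.out : p.Prime).two_le
  have h : ∀ n : ℕ, ((der K p f) ^ n) (e K p 0) ∈ filt K p 0 := fun n => by
    induction n with
    | zero => exact Submodule.subset_span ⟨0, le_rfl, by omega, rfl⟩
    | succ n ih => rw [pow_succ', Module.End.mul_apply]; exact der_mem hf ih
  exact h p

variable (K p) in
/-- The `p`-mapping of the restricted subalgebra `W_0`. -/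
def pMap0 [Fact p.Prime] [CharP K p] (f : W0 K p) : W0 K p := ⟨pMap K p f, pMap_mem f.2⟩

end WittAlgebra

section Reduced

variable {K : Type u} [Field K] {L : Type u} [LieRing L] [LieAlgebra K L]

/-- The relations `x ^ p - x^[p] = χ(x) ^ p` for all `x` in `L`. -/
inductive ReducedRel (p : ℕ) (P : L → L) (χ : L →ₗ[K] K) :
    UniversalEnvelopingAlgebra K L → UniversalEnvelopingAlgebra K L → Prop
  | mk (x : L) : ReducedRel p P χ
      (UniversalEnvelopingAlgebra.ι K x ^ p - UniversalEnvelopingAlgebra.ι K (P x))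
      (algebraMap K (UniversalEnvelopingAlgebra K L) (χ x ^ p))

/-- The reduced enveloping algebra `U_χ(L) = U(L) / (x ^ p - x^[p] - χ(x) ^ p | x ∈ L)` of a Lie
algebra `L` with `p`-mapping `P`. -/
abbrev ReducedEnveloping (p : ℕ) (P : L → L) (χ : L →ₗ[K] K) : Type u :=
  RingQuot (ReducedRel p P χ)

/-- The canonical map `U(L) → U_χ(L)`. -/
def ReducedEnveloping.mk (p : ℕ) (P : L → L) (χ : L →ₗ[K] K) :
    UniversalEnvelopingAlgebra K L →ₐ[K] ReducedEnveloping p P χ :=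
  RingQuot.mkAlgHom K (ReducedRel p P χ)

theorem ReducedEnveloping.mk_rel (p : ℕ) (P : L → L) (χ : L →ₗ[K] K) (x : L) :
    mk p P χ (UniversalEnvelopingAlgebra.ι K x) ^ p - mk p P χ (UniversalEnvelopingAlgebra.ι K (P x))
      = algebraMap K _ (χ x ^ p) := by
  have h : mk p P χ _ = mk p P χ _ := RingQuot.mkAlgHom_rel K (ReducedRel.mk (p := p) (P := P) (χ := χ) x)
  rwa [map_sub, map_pow, AlgHom.commutes] at h

end Reduced

section Induction

/-- The tensor product `B ⊗_A M` over a not necessarily commutative ring `A`, for a ring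
homomorphism `φ : A → B` and a left `A`-module `M`, as a left `B`-module: the quotient of
`B ⊗_ℤ M` by the elements `b φ(a) ⊗ m - b ⊗ a m`. -/
def inducedModule {A B : Type u} [Ring A] [Ring B] (φ : A →+* B) (M : ModuleCat.{u} A) :
    ModuleCat.{u} B :=
  ModuleCat.of B ((B ⊗[ℤ] M) ⧸ Submodule.span B
    {t : B ⊗[ℤ] M | ∃ (b : B) (a : A) (m : M), t = (b * φ a) ⊗ₜ[ℤ] m - b ⊗ₜ[ℤ] (a • m)})

end Induction

namespace WittAlgebra

attribute [local instance 100] LieRing.ofAssociativeRing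

variable {K : Type u} [Field K] {p : ℕ}

section
variable [Fact p.Prime] [CharP K p]

/-- The reduced enveloping algebra `U_χ(W)`. -/
abbrev UW (χ : Module.Dual K (WittAlgebra K p)) : Type u :=
  ReducedEnveloping p (pMap K p) χ

/-- The reduced enveloping algebra `U_χ(W_0)`. -/
abbrev UW0 (χ : Module.Dual K (WittAlgebra K p)) : Type u :=
  ReducedEnveloping p (pMap0 K p) (χ.comp (W0 K p).toSubmodule.subtype)

/-- The homomorphism `U_χ(W_0) → U_χ(W)` induced by the inclusion of `W_0` in `W`. -/
def incl (χ : Module.Dual K (WittAlgebra K p)) : UW0 χ →ₐ[K] UW χ :=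
  RingQuot.liftAlgHom K
    ⟨(ReducedEnveloping.mk p (pMap K p) χ).comp (UniversalEnvelopingAlgebra.lift K
      ((UniversalEnvelopingAlgebra.ι K).comp (W0 K p).incl)), by
      rintro _ _ ⟨x⟩
      rw [map_sub, map_pow, AlgHom.commutes]
      simp only [AlgHom.comp_apply, UniversalEnvelopingAlgebra.lift_ι_apply, LieHom.comp_apply]
      exact ReducedEnveloping.mk_rel p (pMap K p) χ (x : WittAlgebra K p)⟩

end

section
variable [Fact p.Prime]

/-- The coordinate of `f` at `e_0`. -/
def coord0 (f : WittAlgebra K p) : K := f ⟨1, (Fact.out : p.Prime).one_lt⟩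

theorem coord0_der {f : WittAlgebra K p} (hf : f ∈ filt K p 0) (g : WittAlgebra K p) :
    coord0 (der K p f g) = coord0 f * coord0 g := by
  have hp := (Fact.out : p.Prime).one_lt
  rw [mem_filt_iff] at hf
  rw [coord0, der_apply, Finset.sum_eq_single (⟨1, hp⟩ : Fin p),
    Finset.sum_eq_single (⟨1, hp⟩ : Fin p)]
  · simp [coord0]
  · intro b _ hb
    rw [if_neg]
    intro h
    apply hb
    apply Fin.ext
    simp only at h ⊢
    omega
  · simp
  · intro a _ ha
    refine Finset.sum_eq_zero fun b _ => ?_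
    split_ifs with h
    · by_cases ha0 : (a : ℕ) = 0
      · rw [hf a (by omega)]; ring
      · have ha1 : (a : ℕ) ≠ 1 := fun h1 => ha (Fin.ext h1)
        simp only at h
        rw [show (b : ℕ) = 0 by omega]
        simp
    · rfl
  · simp

theorem coord0_pMap {f : WittAlgebra K p} (hf : f ∈ filt K p 0) :
    coord0 (pMap K p f) = coord0 f ^ p := by
  have h : ∀ n : ℕ, coord0 (((der K p f) ^ n) (e K p 0)) = coord0 f ^ n := fun n => by
    induction n with
    | zero => simp [coord0, e_apply]
    | succ n ih => rw [pow_succ', Module.End.mul_apply, coord0_der hf, ih, pow_succ']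
  exact h p

theorem apply_eq_of_height_le_one {χ : Module.Dual K (WittAlgebra K p)} (hχ : height χ ≤ 1)
    {f : WittAlgebra K p} (hf : f ∈ filt K p 0) : χ f = coord0 f * χ (e K p 0) := by
  have hp := (Fact.out : p.Prime).one_lt
  have hne : {i : ℤ | -1 ≤ i ∧ i ≤ (p : ℤ) - 1 ∧ ∀ x ∈ filt K p i, χ x = 0}.Nonempty := by
    refine ⟨(p : ℤ) - 1, by omega, le_rfl, fun x hx => ?_⟩
    rw [mem_filt_iff] at hx
    have : x = 0 := funext fun a => hx a (by have := a.isLt; omega)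
    rw [this, map_zero]
  have hmem := Int.csInf_mem hne ⟨-1, fun i hi => hi.1⟩
  have h1 : f - coord0 f • e K p 0 ∈ filt K p (height χ) := by
    rw [mem_filt_iff] at hf ⊢
    intro a ha
    change f a - coord0 f * e K p 0 a = 0
    rw [e_apply]
    rcases (by omega : (a : ℕ) = 0 ∨ (a : ℕ) = 1) with h | h
    · rw [hf a (by omega), if_neg (by omega)]; ring
    · have : a = ⟨1, hp⟩ := Fin.ext h
      subst this
      simp [coord0]
  have h2 := hmem.2.2 _ h1
  rw [map_sub, map_smul, smul_eq_mul, sub_eq_zero] at h2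
  exact h2

end

variable [Fact p.Prime] [CharP K p]

variable (K p) in
/-- The Lie algebra homomorphism `W_0 → K` with `e_0 ↦ l` and `e_i ↦ 0` for `i > 0`. -/
def lieChar (l : K) : W0 K p →ₗ⁅K⁆ K where
  toFun f := l * coord0 (f : WittAlgebra K p)
  map_add' f g := mul_add l (coord0 (f : WittAlgebra K p)) (coord0 (g : WittAlgebra K p))
  map_smul' r f := mul_left_comm l r (coord0 (f : WittAlgebra K p))
  map_lie' {f g} := by
    have h : coord0 (⁅(f : WittAlgebra K p), (g : WittAlgebra K p)⁆) = 0 := by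
      change coord0 (der K p f g) - coord0 (der K p g f) = 0
      rw [coord0_der f.2, coord0_der g.2]
      ring
    change l * coord0 (⁅(f : WittAlgebra K p), (g : WittAlgebra K p)⁆) = _
    rw [h, mul_zero, LieRing.of_associative_ring_bracket]
    ring

/-- The homomorphism `U_χ(W_0) → K` with `e_0 ↦ l` and `e_i ↦ 0` for `i > 0`. -/
def character (χ : Module.Dual K (WittAlgebra K p)) (hχ : height χ ≤ 1) (l : K)
    (hl : l ∈ weights χ) : UW0 χ →ₐ[K] K :=
  RingQuot.liftAlgHom K ⟨UniversalEnvelopingAlgebra.lift K (lieChar K p l), by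
    rintro _ _ ⟨x⟩
    rw [map_sub, map_pow, AlgHom.commutes, UniversalEnvelopingAlgebra.lift_ι_apply,
      UniversalEnvelopingAlgebra.lift_ι_apply]
    change (l * coord0 (x : WittAlgebra K p)) ^ p - l * coord0 (pMap K p (x : WittAlgebra K p)) =
      χ (x : WittAlgebra K p) ^ p
    have hl' : l ^ p - l = χ (e K p 0) ^ p := hl
    rw [coord0_pMap x.2, apply_eq_of_height_le_one hχ x.2, mul_pow, mul_pow, ← hl']
    ring⟩

/-- The one-dimensional `U_χ(W_0)`-module `K_l`, on which `e_0` acts as `l` and `e_i` as zero for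
`i > 0`. -/
def oneDim (χ : Module.Dual K (WittAlgebra K p)) (hχ : height χ ≤ 1) (l : K)
    (hl : l ∈ weights χ) : ModuleCat.{u} (UW0 χ) :=
  (ModuleCat.restrictScalars (character χ hχ l hl).toRingHom).obj (ModuleCat.of K K)

/-- The reduced Verma module `V_χ(l) = U_χ(W) ⊗_{U_χ(W_0)} K_l`, a `U_χ(W)`-module. -/
def verma (χ : Module.Dual K (WittAlgebra K p)) (hχ : height χ ≤ 1) (l : K)
    (hl : l ∈ weights χ) : ModuleCat.{u} (UW χ) :=
  inducedModule (incl χ).toRingHom (oneDim χ hχ l hl)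

/-- The restriction of `V_χ(l)` to `U_χ(W_0)`. -/
def vermaRes (χ : Module.Dual K (WittAlgebra K p)) (hχ : height χ ≤ 1) (l : K)
    (hl : l ∈ weights χ) : ModuleCat.{u} (UW0 χ) :=
  (ModuleCat.restrictScalars (incl χ).toRingHom).obj (verma χ hχ l hl)

end WittAlgebra

end

/-!
Write `A = U_χ(W_0)`, and let `I` be the kernel of the character `A → K` defining `K_l`. Since `A`
is projective, `Ext¹(K_l, V)` is the quotient of `Hom_A(I, V)`, the space of cocycles, by the maps
`x ↦ x v` (`extConnecting`). So everything comes down to an explicit description of `V` and of the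
cocycles with values in it.

*The Verma module.* On the basis `u_k = (-1)^k / k! • e_{-1}^k ⊗ 1`, for `0 ≤ k < p`, the action
of `W_0` is `e_i u_k = ((i + 1) l + i - k) u_{k-i}`. These formulas, completed by those for
`e_{-1}`, define operators on `K^p` (`modelOp`) that satisfy the relations of `U_χ(W)`: the `p`-th
power relations need only be checked on the `e_i`, by Jacobson's formula (`exists_isJacobson`,
`reducedRel_of_span`). The Verma module is spanned by the `p` vectors `e_{-1}^k ⊗ 1`, whose images
in the model are linearly independent, so it is isomorphic to the model (`exists_verma_equiv`); no
Poincaré-Birkhoff-Witt theorem is needed.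

*Cocycles.* The `e_0`-weights `l - k` of `V` are distinct, so a cocycle `φ` can be changed by a
coboundary to make `φ (e_0 - l) = 0`. Then `φ (e_i)` has weight `l + i`, so it is a multiple
`c_i u_{p-i}`, and the bracket relations become
`((i + 1) l + i + j) c_j - ((j + 1) l + i + j) c_i = (j - i) c_{i+j}` for `i + j ≤ p`,
with the convention `c_{p-1} = c_p = 0`. If `c_1 = 0`, computing `c_5` from the pairs `(1, 4)` and
`(2, 3)` gives `l (2 l + 1) (l + 1) c_2 = 0`, and together with the vanishing of `c_{p-1}` this
forces `c = 0` (`IsCocycleCoeff.eq_zero`). If `l` is none of `0`, `-1`, `-1/2`, subtracting a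
multiple of the formal solution `c_i = (i + 1) l + i` reduces to that case and gives `c_1 = 0`
(`IsCocycleCoeff.apply_one_eq_zero`); for `l = -1/2` this follows from the relation `e_1 ^ p = 0`
(`ModelCocycle.coeff_one_eq_zero_of_half`). Finally, for `l = 0` and `l = -1` the families
`c_i = i (i + 1)` and `c_i = δ_{i1}` define extension modules (`extRep`), hence cocycles with
`c_1 ≠ 0`. So `φ ↦ c_1` identifies `Ext¹` with `K` for `l ∈ {0, -1}`, and for other `l` it vanishes.

In height one, `χ (e_0) ≠ 0`, so `l ^ p ≠ l` and `l` is not in the prime field.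
-/

noncomputable section

/-! ### Jacobson's formula for the `p`-th power of a sum -/

section Jacobson

open Polynomial

attribute [local instance 100] LieRing.ofAssociativeRing

theorem cast_choose_prime_sub_one (p : ℕ) [Fact p.Prime] (B : Type*) [Ring B]
    [CharP B p] {m : ℕ} (hm : m < p) : (((p - 1).choose m : ℕ) : B) = (-1) ^ m := by
  have hp := (Fact.out : p.Prime)
  induction m with
  | zero => simp
  | succ m ih =>
    have h1 : ((p.choose (m + 1) : ℕ) : B) = 0 :=
      (CharP.cast_eq_zero_iff B p _).2 (hp.dvd_choose_self (by omega) hm)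
    obtain ⟨q, rfl⟩ : ∃ q, p = q + 1 := ⟨p - 1, by omega⟩
    rw [Nat.choose_succ_succ, Nat.cast_add] at h1
    rw [Nat.add_sub_cancel] at ih ⊢
    rw [eq_neg_of_add_eq_zero_right h1, ih (by omega), pow_succ]
    simp

theorem derivative_pow_eq_sum {B : Type*} [Ring B] (u : B[X]) (n : ℕ) :
    derivative (u ^ n) =
      ∑ m ∈ Finset.range n, u ^ m * derivative u * u ^ (n - 1 - m) := by
  induction n with
  | zero => simp
  | succ n ih =>
    rw [pow_succ, derivative_mul, ih, Finset.sum_range_succ, Finset.sum_mul]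
    congr 1
    · refine Finset.sum_congr rfl fun m hm => ?_
      have := Finset.mem_range.1 hm
      rw [mul_assoc, ← pow_succ]
      congr 2
      omega
    · simp

/-- In characteristic `p` the binomial coefficients of `(ad u) ^ (p - 1)`, with
`ad u` the difference of left and right multiplication by `u`, are all `1`. -/
theorem sum_pow_mul_mul_pow_eq_lie (p : ℕ) [Fact p.Prime] {B : Type*} [Ring B] [CharP B p]
    (u a : B) :
    ∑ m ∈ Finset.range p, u ^ m * a * u ^ (p - 1 - m) = (fun b : B => ⁅u, b⁆)^[p - 1] a := by
  have hp := (Fact.out : p.Prime).one_lt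
  have h1 : ∀ n, (fun b : B => ⁅u, b⁆)^[n] a =
      ((LinearMap.mulLeft ℤ u + LinearMap.mulRight ℤ (-u)) ^ n) a := fun n => by
    induction n with
    | zero => rfl
    | succ n ih =>
      rw [Function.iterate_succ_apply', ih, pow_succ', Module.End.mul_apply]
      simp [LieRing.of_associative_ring_bracket, sub_eq_add_neg]
  have hc : Commute (LinearMap.mulLeft ℤ u) (LinearMap.mulRight ℤ (-u)) :=
    LinearMap.commute_mulLeft_right u (-u)
  rw [h1, hc.add_pow, Nat.sub_add_cancel hp.le,
    LinearMap.sum_apply]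
  refine Finset.sum_congr rfl fun m hm => ?_
  have hm := Finset.mem_range.1 hm
  rw [← nsmul_eq_mul', LinearMap.smul_apply, Module.End.mul_apply, LinearMap.pow_mulLeft,
    LinearMap.pow_mulRight, LinearMap.mulRight_apply, LinearMap.mulLeft_apply,
    ← Nat.choose_symm (show m ≤ p - 1 by omega), nsmul_eq_mul,
    cast_choose_prime_sub_one p B (by omega), neg_pow u]
  rcases neg_one_pow_eq_or B (p - 1 - m) with h | h <;> simp [h, mul_assoc]

variable {K : Type u} [Field K] {L : Type u} [LieRing L] [LieAlgebra K L]

/-- The coefficient of `T ^ i` in `(ad (x T + y)) ^ n (x)`, an element of `L`. -/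
def jacobsonCoeff (x y : L) : ℕ → ℕ → L
  | 0, 0 => x
  | 0, _ + 1 => 0
  | n + 1, 0 => ⁅y, jacobsonCoeff x y n 0⁆
  | n + 1, i + 1 => ⁅x, jacobsonCoeff x y n i⁆ + ⁅y, jacobsonCoeff x y n (i + 1)⁆

theorem coeff_iterate_lie {B : Type u} [Ring B] [Algebra K B] (ρ : L →ₗ⁅K⁆ B) (x y : L)
    (n i : ℕ) :
    ((fun b : B[X] => ⁅C (ρ x) * X + C (ρ y), b⁆)^[n] (C (ρ x))).coeff i =
      ρ (jacobsonCoeff x y n i) := by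
  induction n generalizing i with
  | zero => cases i <;> simp [jacobsonCoeff, coeff_C]
  | succ n ih =>
    rw [Function.iterate_succ_apply']
    generalize ((fun b : B[X] => ⁅C (ρ x) * X + C (ρ y), b⁆)^[n] (C (ρ x))) = b at ih ⊢
    rw [LieRing.of_associative_ring_bracket, add_mul, mul_add, mul_assoc, X_mul, ← mul_assoc,
      ← mul_assoc]
    cases i with
    | zero =>
      simp [jacobsonCoeff, LieRing.of_associative_ring_bracket, ← ih]
    | succ i =>
      simp [jacobsonCoeff, LieRing.of_associative_ring_bracket, ← ih]
      abel

/-- `s` is a universal correction term for the `p`-th power of `x + y`. -/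
def IsJacobson (K : Type u) [Field K] {L : Type u} [LieRing L] [LieAlgebra K L] (p : ℕ)
    (x y s : L) : Prop :=
  ∀ (B : Type u) [Ring B] [Algebra K B] (ρ : L →ₗ⁅K⁆ B),
    ρ (x + y) ^ p = ρ x ^ p + ρ y ^ p + ρ s

/-- Jacobson's formula: differentiating `(x T + y) ^ p` in `T` gives `(ad (x T + y)) ^ (p - 1) (x)`,
so the mixed terms of `(x + y) ^ p` are values of Lie polynomials. -/
theorem exists_isJacobson (p : ℕ) [Fact p.Prime] [CharP K p] (x y : L) :
    ∃ s : L, IsJacobson K p x y s := by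
  have hp := (Fact.out : p.Prime).one_lt
  refine ⟨∑ i ∈ Finset.range (p - 1), ((i + 1 : ℕ) : K)⁻¹ • jacobsonCoeff x y (p - 1) i, ?_⟩
  intro B _ _ ρ
  rcases subsingleton_or_nontrivial B with hB | hB
  · exact Subsingleton.elim _ _
  have : CharP B p := charP_of_injective_algebraMap (algebraMap K B).injective p
  set U : B[X] := C (ρ x) * X + C (ρ y) with hU
  have hdeg : U.natDegree ≤ 1 := natDegree_linear_le
  have hder : derivative (U ^ p) = (fun b : B[X] => ⁅U, b⁆)^[p - 1] (C (ρ x)) := by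
    rw [derivative_pow_eq_sum, ← sum_pow_mul_mul_pow_eq_lie p]
    simp [hU]
  have hmid : ∀ i ∈ Finset.range (p - 1), (U ^ p).coeff (i + 1) =
      ((i + 1 : ℕ) : K)⁻¹ • ρ (jacobsonCoeff x y (p - 1) i) := fun i hi => by
    have hi := Finset.mem_range.1 hi
    rw [← coeff_iterate_lie, ← hU, ← hder, coeff_derivative]
    have h0 : ((i + 1 : ℕ) : K) ≠ 0 := by
      rw [Ne, CharP.cast_eq_zero_iff K p]
      exact Nat.not_dvd_of_pos_of_lt (by omega) (by omega)
    rw [eq_inv_smul_iff₀ h0, Algebra.smul_def, map_natCast]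
    push_cast
    exact ((Nat.cast_commute i _).add_left (Commute.one_left _)).eq
  have h0 : (U ^ p).coeff 0 = ρ y ^ p := by
    have := map_pow (constantCoeff (R := B)) U p
    simpa [hU] using this
  have h1 : (U ^ p).coeff p = ρ x ^ p := by
    have := coeff_pow_of_natDegree_le (m := p) hdeg
    rw [mul_one] at this
    simpa [hU] using this
  have hev : eval₂ (RingHom.id B) 1 (U ^ p) = (ρ x + ρ y) ^ p := by
    have := map_pow (eval₂RingHom' (RingHom.id B) 1 fun a => Commute.one_right _) U p
    simpa [hU, eval₂RingHom'] using this
  rw [map_add, ← hev, eval₂_eq_sum_range' (RingHom.id B) (n := p + 1)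
    (by have := natDegree_pow_le_of_le p hdeg; omega), Finset.sum_range_succ]
  obtain ⟨q, rfl⟩ : ∃ q, p = q + 1 := ⟨p - 1, by omega⟩
  rw [Finset.sum_range_succ']
  simp only [Nat.add_sub_cancel] at hmid ⊢
  simp only [RingHom.id_apply, one_pow, mul_one, h0, h1, map_sum, map_smul,
    Finset.sum_congr rfl hmid]
  abel

end Jacobson

/-! ### Reduced enveloping algebras: relations and homomorphisms -/

section ReducedHom

attribute [local instance 100] LieRing.ofAssociativeRing

variable {K : Type u} [Field K] {L : Type u} [LieRing L] [LieAlgebra K L]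

/-- A `p`-mapping in Jacobson's sense: `P (x + y) = P x + P y + s` with the correction term `s` of
Jacobson's formula, and `P (r x) = r ^ p P x`. -/
structure IsPMap (K : Type u) [Field K] {L : Type u} [LieRing L] [LieAlgebra K L] (p : ℕ)
    (P : L → L) : Prop where
  add : ∀ x y s, IsJacobson K p x y s → P (x + y) = P x + P y + s
  smul : ∀ (r : K) x, P (r • x) = r ^ p • P x

/-- By Jacobson's formula `x ↦ ρ x ^ p - ρ (P x)` is additive, so the relations of the reduced
enveloping algebra need only be checked on a spanning set. -/
theorem reducedRel_of_span {p : ℕ} [Fact p.Prime] [CharP K p] {P : L → L} (hP : IsPMap K p P)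
    (χ : L →ₗ[K] K) {B : Type u} [Ring B] [Algebra K B] (ρ : L →ₗ⁅K⁆ B) {S : Set L}
    (hS : Submodule.span K S = ⊤)
    (h : ∀ x ∈ S, ρ x ^ p - ρ (P x) = algebraMap K B (χ x ^ p)) (x : L) :
    ρ x ^ p - ρ (P x) = algebraMap K B (χ x ^ p) := by
  have hp := (Fact.out : p.Prime)
  have hx : x ∈ Submodule.span K S := hS ▸ Submodule.mem_top
  have hsm : ∀ (r : K) (x : L), ρ x ^ p - ρ (P x) = algebraMap K B (χ x ^ p) →
      ρ (r • x) ^ p - ρ (P (r • x)) = algebraMap K B (χ (r • x) ^ p) := fun r x hx => by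
    rw [hP.smul, map_smul, map_smul, map_smul, smul_pow, ← smul_sub, hx, smul_eq_mul, mul_pow,
      map_mul, Algebra.smul_def]
  induction hx using Submodule.span_induction with
  | mem x hx => exact h x hx
  | zero =>
    have h0 : P 0 = 0 := by
      have := hP.smul 0 0
      rwa [zero_smul, zero_pow hp.ne_zero, zero_smul] at this
    simp [h0, zero_pow hp.ne_zero]
  | add x y _ _ hx hy =>
    obtain ⟨s, hs⟩ := exists_isJacobson (K := K) p x y
    rw [hP.add x y s hs, hs B ρ, map_add, map_add, map_add, add_pow_char, map_add, ← hx, ← hy]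
    abel
  | smul r x _ hx => exact hsm r x hx

/-- The homomorphism from the reduced enveloping algebra given by a Lie algebra homomorphism that
satisfies the relations. -/
def ReducedEnveloping.lift (p : ℕ) (P : L → L) (χ : L →ₗ[K] K) {B : Type u} [Ring B]
    [Algebra K B] (ρ : L →ₗ⁅K⁆ B)
    (h : ∀ x, ρ x ^ p - ρ (P x) = algebraMap K B (χ x ^ p)) :
    ReducedEnveloping p P χ →ₐ[K] B :=
  RingQuot.liftAlgHom K ⟨UniversalEnvelopingAlgebra.lift K ρ, by
    rintro _ _ ⟨x⟩
    rw [map_sub, map_pow, AlgHom.commutes, UniversalEnvelopingAlgebra.lift_ι_apply,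
      UniversalEnvelopingAlgebra.lift_ι_apply]
    exact h x⟩

variable {p : ℕ} {P : L → L} {χ : L →ₗ[K] K}

/-- The canonical map `L → U_χ(L)`. -/
def ReducedEnveloping.ι (p : ℕ) (P : L → L) (χ : L →ₗ[K] K) : L →ₗ⁅K⁆ ReducedEnveloping p P χ :=
  (ReducedEnveloping.mk p P χ : UniversalEnvelopingAlgebra K L →ₗ⁅K⁆ _).comp
    (UniversalEnvelopingAlgebra.ι K)

theorem ReducedEnveloping.ι_apply (x : L) :
    ι p P χ x = mk p P χ (UniversalEnvelopingAlgebra.ι K x) := rfl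

theorem ReducedEnveloping.ι_pow (x : L) :
    ι p P χ x ^ p = ι p P χ (P x) + algebraMap K _ (χ x ^ p) := by
  rw [← mk_rel p P χ x, ι_apply, ι_apply]
  abel

theorem ReducedEnveloping.liftAlgHom_ι {B : Type u} [Ring B] [Algebra K B]
    (f : UniversalEnvelopingAlgebra K L →ₐ[K] B)
    (hf : ∀ ⦃a b⦄, ReducedRel p P χ a b → f a = f b) (x : L) :
    RingQuot.liftAlgHom K ⟨f, hf⟩ (ι p P χ x) = f (UniversalEnvelopingAlgebra.ι K x) := by
  rw [ι_apply, mk, RingQuot.liftAlgHom_mkAlgHom_apply]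

theorem ReducedEnveloping.lift_ι {B : Type u} [Ring B] [Algebra K B] (ρ : L →ₗ⁅K⁆ B)
    (h : ∀ x, ρ x ^ p - ρ (P x) = algebraMap K B (χ x ^ p)) (x : L) :
    lift p P χ ρ h (ι p P χ x) = ρ x := by
  rw [lift, liftAlgHom_ι, UniversalEnvelopingAlgebra.lift_ι_apply]

theorem ReducedEnveloping.adjoin_range_ι :
    Algebra.adjoin K (Set.range (ι p P χ)) = ⊤ := by
  set S := Algebra.adjoin K (Set.range (ι p P χ)) with hS
  have hmem : ∀ x, ι p P χ x ∈ S := fun x => Algebra.subset_adjoin ⟨x, rfl⟩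
  let ρ : L →ₗ⁅K⁆ S :=
    { toFun := fun x => ⟨ι p P χ x, hmem x⟩
      map_add' := fun x y => Subtype.ext (map_add _ _ _)
      map_smul' := fun r x => Subtype.ext (map_smul (ι p P χ) r x)
      map_lie' := fun {x y} => Subtype.ext (LieHom.map_lie (ι p P χ) x y) }
  have h : ∀ x, ρ x ^ p - ρ (P x) = algebraMap K S (χ x ^ p) := fun x => Subtype.ext (by
    change ι p P χ x ^ p - ι p P χ (P x) = algebraMap K _ (χ x ^ p)
    rw [ι_pow]; abel)
  have hid : S.val.comp (lift p P χ ρ h) = AlgHom.id K _ := by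
    apply RingQuot.ringQuot_ext'
    apply UniversalEnvelopingAlgebra.hom_ext
    ext x
    exact congrArg Subtype.val (lift_ι (P := P) (χ := χ) ρ h x)
  rw [eq_top_iff]
  intro a _
  have := DFunLike.congr_fun hid a
  rw [AlgHom.id_apply] at this
  rw [← this]
  exact (lift p P χ ρ h a).2

/-- A subalgebra that contains the images of a spanning set of `L` is everything. -/
theorem ReducedEnveloping.induction {S : Set L} (hS : Submodule.span K S = ⊤)
    {Q : ReducedEnveloping p P χ → Prop} (halg : ∀ r : K, Q (algebraMap K _ r))
    (hadd : ∀ a b, Q a → Q b → Q (a + b)) (hmul : ∀ a b, Q a → Q b → Q (a * b))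
    (hι : ∀ x ∈ S, Q (ι p P χ x)) (a : ReducedEnveloping p P χ) : Q a := by
  have ha : a ∈ Algebra.adjoin K (Set.range (ι p P χ)) := by
    rw [adjoin_range_ι]; exact Algebra.mem_top
  induction ha using Algebra.adjoin_induction with
  | mem _ hx =>
    obtain ⟨x, rfl⟩ := hx
    have hx : x ∈ Submodule.span K S := hS ▸ Submodule.mem_top
    induction hx using Submodule.span_induction with
    | mem x hx => exact hι x hx
    | zero => simpa using halg 0
    | add x y _ _ hx hy => rw [map_add]; exact hadd _ _ hx hy
    | smul r x _ hx => rw [map_smul, Algebra.smul_def]; exact hmul _ _ (halg r) hx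
  | algebraMap r => exact halg r
  | add a b _ _ ha hb => exact hadd a b ha hb
  | mul a b _ _ ha hb => exact hmul a b ha hb

end ReducedHom

/-! ### The Witt algebra as a restricted Lie algebra -/

namespace WittAlgebra

attribute [local instance 100] LieRing.ofAssociativeRing

variable {K : Type u} [Field K] {p : ℕ}

theorem der_e_zero [CharP K p] (f : WittAlgebra K p) : der K p f (e K p 0) = f := by
  induction f using e_induction with
  | h0 => simp
  | hadd x y hx hy => rw [map_add, LinearMap.add_apply, hx, hy]
  | hsmul r x hx => rw [map_smul, LinearMap.smul_apply, hx]
  | he m =>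
    rw [show e K p 0 = e K p (((1 : ℕ) : ℤ) - 1) by simp, der_e]
    simp

theorem e_eq_zero {i : ℤ} (hi : (p : ℤ) - 1 ≤ i) : e K p i = 0 := by
  funext c
  have := c.isLt
  rw [e_apply, if_neg (by omega)]
  rfl

theorem der_lie [CharP K p] (f g h : WittAlgebra K p) :
    der K p ⁅f, g⁆ h = der K p f (der K p g h) - der K p g (der K p f h) := by
  induction f using e_induction with
  | h0 => simp
  | hadd x y hx hy => simp only [add_lie, map_add, LinearMap.add_apply, hx, hy]; abel
  | hsmul r x hx => simp only [smul_lie, map_smul, LinearMap.smul_apply, hx, smul_sub]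
  | he m =>
  induction g using e_induction with
  | h0 => simp
  | hadd x y hx hy => simp only [lie_add, map_add, LinearMap.add_apply, hx, hy]; abel
  | hsmul r x hx => simp only [lie_smul, map_smul, LinearMap.smul_apply, hx, smul_sub]
  | he n =>
  induction h using e_induction with
  | h0 => simp
  | hadd x y hx hy => simp only [map_add, hx, hy]; abel
  | hsmul r x hx => simp only [map_smul, hx, smul_sub]
  | he k =>
    rcases Nat.eq_zero_or_pos k with rfl | hk
    · rw [lie_e_nat, map_smul, LinearMap.smul_apply, der_e, der_e, der_e]
      simp
    · obtain ⟨k, rfl⟩ : ∃ j, k = j + 1 := ⟨k - 1, by omega⟩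
      rw [lie_e_nat, map_smul, LinearMap.smul_apply, der_e, der_e, der_e, map_smul, map_smul,
        der_e, der_e, smul_smul, smul_smul, smul_smul]
      by_cases h : m + n = 0
      · obtain ⟨rfl, rfl⟩ : m = 0 ∧ n = 0 := by omega
        simp
      · rw [show m + n - 1 + (k + 1) - 1 = m + n + k - 1 by omega,
          show m + (n + (k + 1) - 1) - 1 = m + n + k - 1 by omega,
          show n + (m + (k + 1) - 1) - 1 = m + n + k - 1 by omega, ← sub_smul]
        congr 1
        rw [show n + (k + 1) - 1 = n + k by omega, show m + (k + 1) - 1 = m + k by omega]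
        push_cast
        ring

variable (K p) in
/-- The action of the Witt algebra on `K[x] / (x ^ p)` by derivations. -/
def derHom [CharP K p] : WittAlgebra K p →ₗ⁅K⁆ Module.End K (WittAlgebra K p) where
  __ := der K p
  map_lie' {f g} := LinearMap.ext fun h => der_lie f g h

/-- The `p`-th power of the derivation `f ∂` is the derivation with value `pMap f` at `x`, so
Jacobson's formula for derivations, evaluated at `x`, is the one for `pMap`. -/
theorem pMap_add_of_isJacobson [CharP K p] {x y s : WittAlgebra K p}
    (h : derHom K p (x + y) ^ p = derHom K p x ^ p + derHom K p y ^ p + derHom K p s) :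
    pMap K p (x + y) = pMap K p x + pMap K p y + s := by
  have := LinearMap.congr_fun h (e K p 0)
  rw [LinearMap.add_apply, LinearMap.add_apply] at this
  exact this.trans (congrArg _ (der_e_zero s))

theorem pMap_smul (r : K) (x : WittAlgebra K p) : pMap K p (r • x) = r ^ p • pMap K p x := by
  rw [pMap, map_smul, smul_pow]
  rfl

variable (K p) in
theorem isPMap_pMap [CharP K p] : IsPMap K p (pMap K p) where
  add _ _ _ h := pMap_add_of_isJacobson (h _ (derHom K p))
  smul := pMap_smul

variable (K p) in
theorem isPMap_pMap0 [Fact p.Prime] [CharP K p] : IsPMap K p (pMap0 K p) where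
  add _ _ _ h := Subtype.ext (pMap_add_of_isJacobson (h _ ((derHom K p).comp (W0 K p).incl)))
  smul r x := Subtype.ext (pMap_smul r (x : WittAlgebra K p))

variable (K p) in
theorem span_range_e : Submodule.span K (Set.range fun n : ℕ => e K p ((n : ℤ) - 1)) = ⊤ := by
  refine eq_top_iff.2 fun f _ => ?_
  rw [eq_sum_e f]
  exact Submodule.sum_mem _ fun a _ =>
    Submodule.smul_mem _ _ (Submodule.subset_span ⟨(a : ℕ), rfl⟩)

variable (K) in
/-- The vector `e_i`, for `i ≥ 0`, as an element of `W_0`. -/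
def e0 (p : ℕ) [Fact p.Prime] [CharP K p] (i : ℕ) : W0 K p :=
  ⟨e K p i, by
    by_cases hi : (i : ℤ) ≤ (p : ℤ) - 2
    · exact Submodule.subset_span ⟨i, by omega, hi, rfl⟩
    · rw [e_eq_zero (by omega)]
      exact Submodule.zero_mem (filt K p 0)⟩

theorem coe_e0 [Fact p.Prime] [CharP K p] (i : ℕ) : (e0 K p i : WittAlgebra K p) = e K p i := rfl

variable (K p) in
theorem span_range_e0 [Fact p.Prime] [CharP K p] :
    Submodule.span K (Set.range (e0 K p)) = ⊤ := by
  refine eq_top_iff.2 fun f _ => ?_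
  have hf : (f : WittAlgebra K p) ∈ filt K p 0 := f.2
  have hf' := (mem_filt_iff 0 _).1 hf
  have : f = ∑ a : Fin p, (f : WittAlgebra K p) a • e0 K p ((a : ℕ) - 1) := by
    apply Subtype.ext
    have h1 : (↑(∑ a : Fin p, (f : WittAlgebra K p) a • e0 K p ((a : ℕ) - 1)) : WittAlgebra K p) =
        ∑ a : Fin p, (f : WittAlgebra K p) a • e K p (((a : ℕ) - 1 : ℕ) : ℤ) :=
      map_sum (W0 K p).toSubmodule.subtype _ _
    rw [h1]
    conv_lhs => rw [eq_sum_e (f : WittAlgebra K p)]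
    refine Finset.sum_congr rfl fun a _ => ?_
    by_cases ha : (a : ℕ) = 0
    · rw [hf' a (by omega), zero_smul, zero_smul]
    · congr 2
      omega
  rw [this]
  exact Submodule.sum_mem _ fun a _ =>
    Submodule.smul_mem _ _ (Submodule.subset_span ⟨_, rfl⟩)

section Family

variable {B : Type u} [Ring B] [Algebra K B]

variable (p) in
/-- The linear map on the Witt algebra with `e_{m-1} ↦ r m`. -/
def ofFamily (r : ℕ → B) : WittAlgebra K p →ₗ[K] B where
  toFun f := ∑ a : Fin p, f a • r a
  map_add' f g := by
    rw [← Finset.sum_add_distrib]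
    exact Finset.sum_congr rfl fun a _ => add_smul (f a) (g a) _
  map_smul' c f := by
    rw [Finset.smul_sum]
    exact Finset.sum_congr rfl fun a _ => mul_smul c (f a) _

theorem ofFamily_e {r : ℕ → B} (hr : ∀ m, p ≤ m → r m = 0) (m : ℕ) :
    ofFamily p r (e K p ((m : ℤ) - 1)) = r m := by
  change ∑ a : Fin p, e K p ((m : ℤ) - 1) a • r a = r m
  by_cases hm : m < p
  · rw [Finset.sum_eq_single (⟨m, hm⟩ : Fin p)]
    · rw [e_apply, if_pos (by simp), one_smul]
    · intro b _ hb
      rw [e_apply, if_neg, zero_smul]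
      intro h
      apply hb
      apply Fin.ext
      simp only
      omega
    · simp
  · rw [hr m (by omega), e_eq_zero (by omega)]
    exact Finset.sum_eq_zero fun a _ => zero_smul _ _

theorem ofFamily_lie [CharP K p] {r : ℕ → B} (hr : ∀ m, p ≤ m → r m = 0) (s : ℕ)
    (h : ∀ m n, s ≤ m → s ≤ n → r m * r n - r n * r m = ((n : K) - m) • r (m + n - 1))
    {f g : WittAlgebra K p} (hf : f ∈ filt K p ((s : ℤ) - 1)) (hg : g ∈ filt K p ((s : ℤ) - 1)) :
    ofFamily p r ⁅f, g⁆ = ofFamily p r f * ofFamily p r g - ofFamily p r g * ofFamily p r f := by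
  induction hf using Submodule.span_induction with
  | zero => simp
  | add x y _ _ hx hy => rw [add_lie, map_add, map_add, hx, hy]; noncomm_ring
  | smul c x _ hx =>
    rw [smul_lie, map_smul, map_smul, hx, smul_mul_assoc, mul_smul_comm, smul_sub]
  | mem x hx =>
    obtain ⟨i, hi, -, rfl⟩ := hx
    obtain ⟨m, rfl⟩ : ∃ m : ℕ, i = (m : ℤ) - 1 := ⟨(i + 1).toNat, by omega⟩
    induction hg using Submodule.span_induction with
    | zero => simp
    | add x y _ _ hx hy => rw [lie_add, map_add, map_add, hx, hy]; noncomm_ring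
    | smul c x _ hx =>
      rw [lie_smul, map_smul, map_smul, hx, smul_mul_assoc, mul_smul_comm, smul_sub]
    | mem x hx =>
      obtain ⟨j, hj, -, rfl⟩ := hx
      obtain ⟨n, rfl⟩ : ∃ n : ℕ, j = (n : ℤ) - 1 := ⟨(j + 1).toNat, by omega⟩
      rw [lie_e_nat, map_smul, ofFamily_e hr, ofFamily_e hr, ofFamily_e hr,
        h m n (by omega) (by omega)]

/-- The Lie algebra homomorphism on `W` with `e_{m-1} ↦ r m`. -/
def lieHomOfFamily [CharP K p] {r : ℕ → B} (hr : ∀ m, p ≤ m → r m = 0)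
    (h : ∀ m n, r m * r n - r n * r m = ((n : K) - m) • r (m + n - 1)) :
    WittAlgebra K p →ₗ⁅K⁆ B where
  __ := ofFamily p r
  map_lie' {f g} := by
    have hmem : ∀ f : WittAlgebra K p, f ∈ filt K p (((0 : ℕ) : ℤ) - 1) := fun f => by
      rw [mem_filt_iff]; intro a ha; omega
    exact ofFamily_lie hr 0 (fun m n _ _ => h m n) (hmem f) (hmem g)

/-- The Lie algebra homomorphism on `W_0` with `e_{m-1} ↦ r m` for `m ≥ 1`. -/
def lieHomOfFamily0 [Fact p.Prime] [CharP K p] {r : ℕ → B} (hr : ∀ m, p ≤ m → r m = 0)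
    (h : ∀ m n, 1 ≤ m → 1 ≤ n → r m * r n - r n * r m = ((n : K) - m) • r (m + n - 1)) :
    W0 K p →ₗ⁅K⁆ B where
  __ := (ofFamily p r).comp (W0 K p).toSubmodule.subtype
  map_lie' {f g} := by
    have hmem : ∀ f : W0 K p, (f : WittAlgebra K p) ∈ filt K p (((1 : ℕ) : ℤ) - 1) := fun f => by
      rw [Nat.cast_one, sub_self]; exact f.2
    exact ofFamily_lie hr 1 h (hmem f) (hmem g)

theorem lieHomOfFamily_e [CharP K p] {r : ℕ → B} (hr : ∀ m, p ≤ m → r m = 0)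
    (h : ∀ m n, r m * r n - r n * r m = ((n : K) - m) • r (m + n - 1)) (m : ℕ) :
    lieHomOfFamily hr h (e K p ((m : ℤ) - 1)) = r m := ofFamily_e hr m

theorem lieHomOfFamily0_e0 [Fact p.Prime] [CharP K p] {r : ℕ → B} (hr : ∀ m, p ≤ m → r m = 0)
    (h : ∀ m n, 1 ≤ m → 1 ≤ n → r m * r n - r n * r m = ((n : K) - m) • r (m + n - 1)) (i : ℕ) :
    lieHomOfFamily0 hr h (e0 K p i) = r (i + 1) := by
  rw [← ofFamily_e (K := K) hr (i + 1)]
  change ofFamily p r (e K p i) = _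
  congr 2
  push_cast
  ring

end Family

/-! ### An explicit model of the reduced Verma module -/

/-- The coordinates of a vector, continued by zero to all natural numbers. -/
def hat (x : Fin p → K) (k : ℕ) : K := if h : k < p then x ⟨k, h⟩ else 0

theorem hat_of_le (x : Fin p → K) {k : ℕ} (h : p ≤ k) : hat x k = 0 := dif_neg (by omega)

theorem hat_fin (x : Fin p → K) (k : Fin p) : hat x k = x k := dif_pos k.isLt

@[simp] theorem hat_add (x y : Fin p → K) (k : ℕ) : hat (x + y) k = hat x k + hat y k := by
  unfold hat; split_ifs <;> simp

@[simp] theorem hat_sub (x y : Fin p → K) (k : ℕ) : hat (x - y) k = hat x k - hat y k := by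
  unfold hat; split_ifs <;> simp

@[simp] theorem hat_smul (c : K) (x : Fin p → K) (k : ℕ) : hat (c • x) k = c * hat x k := by
  unfold hat; split_ifs <;> simp

@[simp] theorem hat_zero (k : ℕ) : hat (0 : Fin p → K) k = 0 := by
  unfold hat; split_ifs <;> simp

theorem hat_ext {x y : Fin p → K} (h : ∀ k, hat x k = hat y k) : x = y := by
  funext k
  rw [← hat_fin x, ← hat_fin y, h]

variable (K p) in
/-- The basis vector `u_k` of the model; it is zero for `k ≥ p`. -/
def uvec (k : ℕ) : Fin p → K := fun j => if (j : ℕ) = k then 1 else 0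

theorem hat_uvec (j k : ℕ) : hat (uvec K p j) k = if k = j ∧ k < p then 1 else 0 := by
  unfold hat uvec
  by_cases h : k < p <;> simp [h]

/-- The action of `e_{m-1}` on the model. In terms of the basis, `e_i u_k` is
`((i + 1) l + i - k) u_{k-i}`, with the exception of `e_{-1} u_{p-1} = -t u_0`. Here `u_k` stands
for `(-1)^k / k! • e_{-1}^k ⊗ 1` and `t` for the scalar `e_{-1} ^ p`. -/
def modelOp (t l : K) (m : ℕ) : Module.End K (Fin p → K) where
  toFun x k := ((m : K) * l - (k : ℕ)) * hat x (k + m - 1) +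
    if m = 0 ∧ (k : ℕ) = 0 then -t * hat x (p - 1) else 0
  map_add' x y := by
    funext k
    simp only [hat_add, Pi.add_apply]
    split_ifs <;> ring
  map_smul' c x := by
    funext k
    simp only [hat_smul, Pi.smul_apply, smul_eq_mul, RingHom.id_apply]
    split_ifs <;> ring

theorem hat_modelOp [CharP K p] (t l : K) (m : ℕ) (x : Fin p → K) (k : ℕ) :
    hat (modelOp t l m x) k = ((m : K) * l - k) * hat x (k + m - 1) +
      if m = 0 ∧ k = 0 then -t * hat x (p - 1) else 0 := by
  by_cases hk : k < p
  · exact (dif_pos hk).trans rfl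
  · rw [hat_of_le _ (by omega)]
    by_cases hm : m = 0
    · subst hm
      rcases Nat.eq_zero_or_pos k with rfl | hk0
      · obtain rfl : p = 0 := by omega
        rw [hat_of_le x (Nat.zero_le _)]; simp
      rw [if_neg (by omega), add_zero]
      by_cases hkp : k = p
      · subst hkp; simp
      · rw [hat_of_le x (by omega), mul_zero]
    · rw [if_neg (by omega), hat_of_le x (by omega), mul_zero, add_zero]

theorem hat_modelOp_of_pos [CharP K p] (t l : K) {m : ℕ} (hm : 1 ≤ m) (x : Fin p → K) (k : ℕ) :
    hat (modelOp t l m x) k = ((m : K) * l - k) * hat x (k + m - 1) := by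
  rw [hat_modelOp, if_neg (by omega), add_zero]

theorem modelOp_eq_zero [CharP K p] [Fact p.Prime] (t l : K) {m : ℕ} (hm : p ≤ m) :
    (modelOp t l m : Module.End K (Fin p → K)) = 0 := by
  have hp := (Fact.out : p.Prime).pos
  refine LinearMap.ext fun x => hat_ext fun k => ?_
  rw [hat_modelOp_of_pos _ _ (by omega), LinearMap.zero_apply, hat_zero]
  by_cases h : k + m - 1 < p
  · obtain ⟨rfl, rfl⟩ : k = 0 ∧ m = p := by omega
    simp
  · rw [hat_of_le x (by omega), mul_zero]

theorem modelOp_lie_pos [CharP K p] (t l : K) {m n : ℕ} (hm : 1 ≤ m) (hn : 1 ≤ n) :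
    (modelOp t l m * modelOp t l n - modelOp t l n * modelOp t l m :
      Module.End K (Fin p → K)) = ((n : K) - m) • modelOp t l (m + n - 1) := by
  refine LinearMap.ext fun x => hat_ext fun k => ?_
  obtain ⟨m, rfl⟩ : ∃ j, m = j + 1 := ⟨m - 1, by omega⟩
  obtain ⟨n, rfl⟩ : ∃ j, n = j + 1 := ⟨n - 1, by omega⟩
  simp only [LinearMap.sub_apply, Module.End.mul_apply, LinearMap.smul_apply, hat_sub, hat_smul]
  rw [hat_modelOp_of_pos _ _ hm, hat_modelOp_of_pos _ _ hn, hat_modelOp_of_pos _ _ hn,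
    hat_modelOp_of_pos _ _ hm, hat_modelOp_of_pos _ _ (by omega),
    show k + (m + 1) - 1 + (n + 1) - 1 = k + m + n by omega,
    show k + (n + 1) - 1 + (m + 1) - 1 = k + m + n by omega,
    show m + 1 + (n + 1) - 1 = m + n + 1 by omega,
    show k + (m + n + 1) - 1 = k + m + n by omega,
    show k + (m + 1) - 1 = k + m by omega, show k + (n + 1) - 1 = k + n by omega]
  push_cast
  ring

theorem modelOp_lie_zero [CharP K p] [Fact p.Prime] (t l : K) {n : ℕ} (hn : 1 ≤ n) :
    (modelOp t l 0 * modelOp t l n - modelOp t l n * modelOp t l 0 :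
      Module.End K (Fin p → K)) = (n : K) • modelOp t l (n - 1) := by
  have hp := (Fact.out : p.Prime).two_le
  refine LinearMap.ext fun x => hat_ext fun k => ?_
  obtain ⟨n, rfl⟩ : ∃ j, n = j + 1 := ⟨n - 1, by omega⟩
  simp only [LinearMap.sub_apply, Module.End.mul_apply, LinearMap.smul_apply, hat_sub, hat_smul]
  rw [hat_modelOp_of_pos _ _ hn, hat_modelOp, hat_modelOp_of_pos _ _ hn, hat_modelOp_of_pos _ _ hn,
    hat_modelOp, hat_modelOp]
  simp only [Nat.add_sub_cancel, ← Nat.add_assoc, Nat.add_zero]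
  rcases Nat.eq_zero_or_pos k with rfl | hk
  · rcases Nat.eq_zero_or_pos n with rfl | hn0
    · simp [Nat.cast_sub (show 1 ≤ p by omega)]
      ring
    · rw [hat_of_le x (show p ≤ p - 1 + n by omega)]
      simp [hn0.ne']
      ring
  · obtain ⟨k, rfl⟩ : ∃ j, k = j + 1 := ⟨k - 1, by omega⟩
    simp only [Nat.add_sub_cancel, show k + 1 + n - 1 = k + n by omega]
    simp
    ring

theorem modelOp_lie [CharP K p] [Fact p.Prime] (t l : K) (m n : ℕ) :
    (modelOp t l m * modelOp t l n - modelOp t l n * modelOp t l m :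
      Module.End K (Fin p → K)) = ((n : K) - m) • modelOp t l (m + n - 1) := by
  rcases Nat.eq_zero_or_pos m with rfl | hm
  · rcases Nat.eq_zero_or_pos n with rfl | hn
    · simp
    · simpa using modelOp_lie_zero t l hn
  · rcases Nat.eq_zero_or_pos n with rfl | hn
    · rw [← neg_sub, modelOp_lie_zero t l hm]
      rw [Nat.cast_zero, zero_sub, Nat.add_zero]
      exact (neg_smul _ _).symm
    · exact modelOp_lie_pos t l hm hn

theorem modelOp_zero_uvec [CharP K p] (t l : K) {k : ℕ} (hk : k + 1 < p) :
    modelOp t l 0 (uvec K p k) = (-((k + 1 : ℕ) : K)) • uvec K p (k + 1) := by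
  refine hat_ext fun j => ?_
  rw [hat_modelOp, hat_smul, hat_uvec, hat_uvec, hat_uvec, if_neg (show ¬(p - 1 = k ∧ _) by omega)]
  rcases Nat.eq_zero_or_pos j with rfl | hj
  · simp
  · by_cases h : j = k + 1
    · subst h
      simp [hk, show k < p by omega]
    · simp [h, show ¬ (j - 1 = k) by omega]

theorem modelOp_zero_pow_uvec [CharP K p] (t l : K) {k : ℕ} (hk : k < p) :
    (modelOp t l 0 ^ k) (uvec K p 0) = ((-1) ^ k * (k.factorial : K)) • uvec K p k := by
  induction k with
  | zero => simp
  | succ k ih =>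
    rw [pow_succ', Module.End.mul_apply, ih (by omega), map_smul, modelOp_zero_uvec t l hk,
      smul_smul, Nat.factorial_succ]
    congr 1
    push_cast
    ring

theorem factorial_ne_zero_of_lt [Fact p.Prime] [CharP K p] {k : ℕ} (hk : k < p) :
    (k.factorial : K) ≠ 0 := by
  rw [Ne, CharP.cast_eq_zero_iff K p, (Fact.out : p.Prime).dvd_factorial]
  omega

theorem eq_sum_uvec (x : Fin p → K) : x = ∑ k : Fin p, x k • uvec K p k := by
  refine (pi_eq_sum_univ x).trans (Finset.sum_congr rfl fun k _ => ?_)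
  congr 1
  funext j
  simp [uvec, Fin.ext_iff, eq_comm]

variable (K p) in
theorem cast_pred_factorial [Fact p.Prime] [CharP K p] : ((p - 1).factorial : K) = -1 := by
  have h := congrArg (ZMod.castHom (dvd_refl p) K) (ZMod.wilsons_lemma p)
  rwa [map_natCast, map_neg, map_one] at h

/-- `e_{-1} ^ p` acts on the model as `t`: it does so on the generator `u_0`, by Wilson's theorem,
and it commutes with `e_{-1}`. -/
theorem modelOp_zero_pow_p [Fact p.Prime] [CharP K p] (t l : K) :
    (modelOp t l 0 : Module.End K (Fin p → K)) ^ p = algebraMap K _ t := by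
  have hp := (Fact.out : p.Prime).two_le
  have h0 : (modelOp t l 0 ^ p) (uvec K p 0) = t • uvec K p 0 := by
    obtain ⟨q, rfl⟩ : ∃ q, p = q + 1 := ⟨p - 1, by omega⟩
    have hw := cast_pred_factorial K (q + 1)
    rw [Nat.add_sub_cancel] at hw
    rw [pow_succ', Module.End.mul_apply, modelOp_zero_pow_uvec t l (by omega), hw, map_smul]
    refine hat_ext fun j => ?_
    have h1 : (-1 : K) ^ (q + 1) = -1 := neg_one_pow_char K (q + 1)
    have h2 : (-1 : K) ^ q = 1 := by
      rw [pow_succ] at h1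
      simpa using h1
    rw [h2, hat_smul, hat_modelOp, hat_smul, hat_uvec, hat_uvec, hat_uvec]
    by_cases hj : j = 0
    · subst hj; simp
    · by_cases hjq : j - 1 = q
      · obtain rfl : j = q + 1 := by omega
        simp
      · simp [hj, hjq]
  refine LinearMap.ext fun x => ?_
  rw [Module.algebraMap_end_apply]
  conv_lhs => rw [eq_sum_uvec x]
  conv_rhs => rw [eq_sum_uvec x]
  rw [map_sum, Finset.smul_sum]
  refine Finset.sum_congr rfl fun k _ => ?_
  rw [map_smul, smul_comm t]
  congr 1
  have hk := modelOp_zero_pow_uvec t l k.isLt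
  have hc : ((-1) ^ (k : ℕ) * ((k : ℕ).factorial : K)) ≠ 0 :=
    mul_ne_zero (pow_ne_zero _ (by simp)) (factorial_ne_zero_of_lt k.isLt)
  rw [eq_comm, ← eq_inv_smul_iff₀ hc] at hk
  rw [hk, map_smul, ← Module.End.mul_apply, ← pow_add, add_comm, pow_add, Module.End.mul_apply, h0,
    map_smul, smul_comm t]

theorem hat_modelOp_one_pow [CharP K p] (t l : K) (j : ℕ) (x : Fin p → K) (k : ℕ) :
    hat ((modelOp t l 1 ^ j) x) k = (l - k) ^ j * hat x k := by
  induction j with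
  | zero => simp
  | succ j ih =>
    rw [pow_succ', Module.End.mul_apply, hat_modelOp_of_pos _ _ le_rfl, Nat.add_sub_cancel, ih]
    push_cast
    ring

theorem natCast_pow_char [Fact p.Prime] [CharP K p] (k : ℕ) : (k : K) ^ p = k :=
  map_natCast (frobenius K p) k

theorem modelOp_one_pow_p [Fact p.Prime] [CharP K p] (t l : K) :
    (modelOp t l 1 : Module.End K (Fin p → K)) ^ p - modelOp t l 1 =
      algebraMap K _ (l ^ p - l) := by
  refine LinearMap.ext fun x => hat_ext fun k => ?_
  rw [Module.algebraMap_end_apply, LinearMap.sub_apply, hat_sub, hat_smul, hat_modelOp_one_pow,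
    hat_modelOp_of_pos _ _ le_rfl, Nat.add_sub_cancel, sub_pow_char, natCast_pow_char]
  push_cast
  ring

theorem exists_hat_modelOp_pow [CharP K p] (t l : K) {m : ℕ} (hm : 1 ≤ m) (j k : ℕ) :
    ∃ c : K, ∀ x : Fin p → K,
      hat ((modelOp t l m ^ j) x) k = c * hat x (k + j * (m - 1)) := by
  induction j generalizing k with
  | zero => exact ⟨1, fun x => by simp⟩
  | succ j ih =>
    obtain ⟨c, hc⟩ := ih (k + m - 1)
    refine ⟨((m : K) * l - k) * c, fun x => ?_⟩
    rw [pow_succ', Module.End.mul_apply, hat_modelOp_of_pos _ _ hm, hc,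
      show k + m - 1 + j * (m - 1) = k + (j + 1) * (m - 1) by rw [Nat.succ_mul]; omega]
    ring

theorem modelOp_pow_p [CharP K p] (t l : K) {m : ℕ} (hm : 2 ≤ m) :
    (modelOp t l m : Module.End K (Fin p → K)) ^ p = 0 := by
  refine LinearMap.ext fun x => hat_ext fun k => ?_
  obtain ⟨c, hc⟩ := exists_hat_modelOp_pow (p := p) t l (show 1 ≤ m by omega) p k
  have : p * 1 ≤ p * (m - 1) := Nat.mul_le_mul_left p (by omega)
  rw [hc, hat_of_le x (by omega), LinearMap.zero_apply, hat_zero, mul_zero]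

theorem pMap_zero [Fact p.Prime] : pMap K p 0 = 0 := by
  have := pMap_smul (p := p) (0 : K) 0
  rwa [zero_smul, zero_pow (Fact.out : p.Prime).ne_zero, zero_smul] at this

theorem pMap_e_nat [Fact p.Prime] [CharP K p] (hp : 3 < p) (m : ℕ) :
    pMap K p (e K p ((m : ℤ) - 1)) = if m = 1 then e K p ((m : ℤ) - 1) else 0 := by
  by_cases hm : m < p
  · rw [pMap_e hp _ (by omega) (by omega)]
    exact if_congr (by omega) rfl rfl
  · rw [e_eq_zero (by omega), pMap_zero, ite_self]

theorem apply_e_of_height_le_one [Fact p.Prime] {χ : Module.Dual K (WittAlgebra K p)}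
    (hχ : height χ ≤ 1) {m : ℕ} (hm : 2 ≤ m) : χ (e K p ((m : ℤ) - 1)) = 0 := by
  by_cases h : m < p
  · have hmem : e K p ((m : ℤ) - 1) ∈ filt K p 0 :=
      Submodule.subset_span ⟨(m : ℤ) - 1, by omega, by omega, rfl⟩
    rw [apply_eq_of_height_le_one hχ hmem, coord0, e_apply, if_neg (by simp only; omega), zero_mul]
  · rw [e_eq_zero (by omega), map_zero]

section Rep

variable [Fact p.Prime] [CharP K p]

/-- The representation of `U_χ(W)` on the model. -/
def modelRep (hp : 3 < p) (χ : Module.Dual K (WittAlgebra K p)) (hχ : height χ ≤ 1) (l : K)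
    (hl : l ∈ weights χ) : UW χ →ₐ[K] Module.End K (Fin p → K) :=
  ReducedEnveloping.lift p (pMap K p) χ
    (lieHomOfFamily (fun _ => modelOp_eq_zero (χ (e K p (-1)) ^ p) l) (modelOp_lie _ l)) <| by
    refine reducedRel_of_span (isPMap_pMap K p) χ _ (span_range_e K p) ?_
    rintro _ ⟨m, rfl⟩
    simp only
    rw [pMap_e_nat hp, lieHomOfFamily_e]
    rcases (by omega : m = 0 ∨ m = 1 ∨ 2 ≤ m) with rfl | rfl | hm
    · rw [modelOp_zero_pow_p]
      simp
    · rw [if_pos rfl, lieHomOfFamily_e, modelOp_one_pow_p, show l ^ p - l = _ from hl]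
      simp
    · rw [if_neg (by omega), map_zero, modelOp_pow_p _ _ hm, apply_e_of_height_le_one hχ hm,
        zero_pow (Fact.out : p.Prime).ne_zero, map_zero, sub_zero]

theorem modelRep_ι (hp : 3 < p) (χ : Module.Dual K (WittAlgebra K p)) (hχ : height χ ≤ 1) (l : K)
    (hl : l ∈ weights χ) (m : ℕ) :
    modelRep hp χ hχ l hl (ReducedEnveloping.ι p (pMap K p) χ (e K p ((m : ℤ) - 1))) =
      modelOp (χ (e K p (-1)) ^ p) l m := by
  rw [modelRep, ReducedEnveloping.lift_ι, lieHomOfFamily_e]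

end Rep

end WittAlgebra

/-! ### The reduced Verma module is isomorphic to the model -/

section InducedModule

variable {A B : Type u} [Ring A] [Ring B] (φ : A →+* B) (M : ModuleCat.{u} A)

/-- The class of `b ⊗ m` in the induced module. -/
def inducedModule.tmul (b : B) (m : M) : inducedModule φ M := Submodule.Quotient.mk (b ⊗ₜ[ℤ] m)

theorem inducedModule.tmul_smul (b : B) (a : A) (m : M) :
    tmul φ M b (a • m) = tmul φ M (b * φ a) m := by
  symm
  refine (Submodule.Quotient.eq _).2 (Submodule.subset_span ?_)
  exact ⟨b, a, m, rfl⟩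

theorem inducedModule.induction {Q : inducedModule φ M → Prop} (h0 : Q 0)
    (htmul : ∀ b m, Q (tmul φ M b m)) (hadd : ∀ x y, Q x → Q y → Q (x + y))
    (x : inducedModule φ M) : Q x := by
  obtain ⟨x, rfl⟩ := Submodule.Quotient.mk_surjective _ x
  induction x using TensorProduct.induction_on with
  | zero => exact h0
  | tmul b m => exact htmul b m
  | add x y hx hy => exact hadd _ _ hx hy

/-- The universal property of the induced module. -/
def inducedModule.lift {N : Type u} [AddCommGroup N] [Module B N] (g : M →+ N)
    (hg : ∀ a m, g (a • m) = φ a • g m) : inducedModule φ M →ₗ[B] N :=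
  Submodule.liftQ _ (TensorProduct.AlgebraTensorModule.lift
    (LinearMap.toSpanSingleton B (M →ₗ[ℤ] N) g.toIntLinearMap)) <| by
    rw [Submodule.span_le]
    rintro _ ⟨b, a, m, rfl⟩
    simp [hg, mul_smul]

theorem inducedModule.lift_tmul {N : Type u} [AddCommGroup N] [Module B N] (g : M →+ N)
    (hg : ∀ a m, g (a • m) = φ a • g m) (b : B) (m : M) :
    lift φ M g hg (tmul φ M b m) = b • g m := rfl

end InducedModule

namespace WittAlgebra

attribute [local instance 100] LieRing.ofAssociativeRing

variable {K : Type u} [Field K] {p : ℕ} [CharP K p]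

/-- The image of `e_{m-1}` in `U_χ(W)`. -/
abbrev eW (χ : Module.Dual K (WittAlgebra K p)) (m : ℕ) : UW χ :=
  ReducedEnveloping.ι p (pMap K p) χ (e K p ((m : ℤ) - 1))

theorem eW_mul_sub (χ : Module.Dual K (WittAlgebra K p)) (m n : ℕ) :
    eW χ m * eW χ n - eW χ n * eW χ m = ((n : K) - m) • eW χ (m + n - 1) := by
  rw [← LieRing.of_associative_ring_bracket, ← LieHom.map_lie, lie_e_nat, map_smul]

theorem modelOp_uvec_zero (t l : K) (i : ℕ) :
    modelOp t l (i + 1) (uvec K p 0) = (if i = 0 then l else 0) • uvec K p 0 := by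
  refine hat_ext fun k => ?_
  rw [hat_modelOp_of_pos _ _ (by omega), hat_smul, hat_uvec, hat_uvec]
  by_cases hi : i = 0
  · subst hi
    by_cases hk : k = 0
    · subst hk; simp
    · simp [hk]
  · simp [hi]

variable [Fact p.Prime]

/-- The image of `e_i`, for `i ≥ 0`, in `U_χ(W_0)`. -/
abbrev eW0 (χ : Module.Dual K (WittAlgebra K p)) (i : ℕ) : UW0 χ :=
  ReducedEnveloping.ι p (pMap0 K p) (χ.comp (W0 K p).toSubmodule.subtype) (e0 K p i)

theorem incl_eW0 (χ : Module.Dual K (WittAlgebra K p)) (i : ℕ) :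
    incl χ (eW0 χ i) = eW χ (i + 1) := by
  rw [incl, eW0, ReducedEnveloping.liftAlgHom_ι]
  simp only [AlgHom.comp_apply, UniversalEnvelopingAlgebra.lift_ι_apply, LieHom.comp_apply]
  rw [eW, ReducedEnveloping.ι_apply]
  congr 3
  push_cast
  simp [coe_e0]

theorem character_eW0 (χ : Module.Dual K (WittAlgebra K p)) (hχ : height χ ≤ 1) (l : K)
    (hl : l ∈ weights χ) (i : ℕ) : character χ hχ l hl (eW0 χ i) = if i = 0 then l else 0 := by
  rw [character, eW0, ReducedEnveloping.liftAlgHom_ι, UniversalEnvelopingAlgebra.lift_ι_apply]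
  change l * coord0 (e K p (i : ℤ)) = _
  rw [coord0, e_apply]
  by_cases hi : i = 0
  · simp [hi]
  · rw [if_neg (by simp only; omega), if_neg hi, mul_zero]

theorem eW_zero_pow (χ : Module.Dual K (WittAlgebra K p)) (hp : 3 < p) :
    eW χ 0 ^ p = algebraMap K _ (χ (e K p (-1)) ^ p) := by
  rw [eW, ReducedEnveloping.ι_pow, pMap_e_nat hp]
  simp

/-- A `U_χ(W)`-module generated by a vector `v` with `e_i v ∈ K v` for all `i ≥ 0` is spanned by
the vectors `e_{-1} ^ k v` with `k < p`. -/
theorem span_eW_zero_pow_smul (χ : Module.Dual K (WittAlgebra K p)) (hp : 3 < p) {V : Type u}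
    [AddCommGroup V] [Module K V] [Module (UW χ) V] [IsScalarTower K (UW χ) V] (v : V)
    (hv : ∀ i, ∃ c : K, eW χ (i + 1) • v = c • v) (a : UW χ) :
    a • v ∈ Submodule.span K (Set.range fun k : Fin p => eW χ 0 ^ (k : ℕ) • v) := by
  set S := Submodule.span K (Set.range fun k : Fin p => eW χ 0 ^ (k : ℕ) • v) with hS
  have h1 : ∀ k : ℕ, eW χ 0 ^ k • v ∈ S := fun k => by
    have hk : k % p < p := Nat.mod_lt _ (by omega)
    rw [← Nat.div_add_mod k p, pow_add, pow_mul, eW_zero_pow χ hp, ← map_pow, mul_smul,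
      algebraMap_smul]
    exact Submodule.smul_mem _ _ (Submodule.subset_span ⟨⟨k % p, hk⟩, rfl⟩)
  have hS0 : ∀ w ∈ S, eW χ 0 • w ∈ S := fun w hw => by
    induction hw using Submodule.span_induction with
    | zero => rw [smul_zero]; exact S.zero_mem
    | add x y _ _ hx hy => rw [smul_add]; exact S.add_mem hx hy
    | smul c x _ hx => rw [smul_comm]; exact S.smul_mem c hx
    | mem x hx =>
      obtain ⟨k, rfl⟩ := hx
      simp only
      rw [← mul_smul, ← pow_succ']
      exact h1 _
  have h2 : ∀ k m : ℕ, eW χ m • eW χ 0 ^ k • v ∈ S := fun k => by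
    induction k with
    | zero =>
      intro m
      cases m with
      | zero => simpa using h1 1
      | succ i =>
        obtain ⟨c, hc⟩ := hv i
        rw [pow_zero, one_smul, hc]
        exact S.smul_mem c (by simpa using h1 0)
    | succ k ih =>
      intro m
      have := eW_mul_sub χ m 0
      rw [sub_eq_iff_eq_add] at this
      rw [pow_succ', ← mul_smul, ← mul_assoc, this, add_mul, add_smul, smul_mul_assoc,
        smul_assoc, mul_smul, mul_smul, mul_smul]
      exact S.add_mem (S.smul_mem _ (ih _)) (hS0 _ (ih _))
  have h3 : ∀ a : UW χ, ∀ w ∈ S, a • w ∈ S := fun a => by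
    induction a using ReducedEnveloping.induction (span_range_e K p) with
    | halg r => intro w hw; rw [algebraMap_smul]; exact S.smul_mem r hw
    | hadd a b ha hb => intro w hw; rw [add_smul]; exact S.add_mem (ha w hw) (hb w hw)
    | hmul a b ha hb => intro w hw; rw [mul_smul]; exact ha _ (hb w hw)
    | hι x hx =>
      obtain ⟨m, rfl⟩ := hx
      intro w hw
      induction hw using Submodule.span_induction with
      | zero => rw [smul_zero]; exact S.zero_mem
      | add x y _ _ hx hy => rw [smul_add]; exact S.add_mem hx hy
      | smul c x _ hx => rw [smul_comm]; exact S.smul_mem c hx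
      | mem x hx =>
        obtain ⟨k, rfl⟩ := hx
        exact h2 k m
  exact h3 a v (by simpa using h1 0)

theorem modelRep_incl_uvec_zero (hp : 3 < p) (χ : Module.Dual K (WittAlgebra K p))
    (hχ : height χ ≤ 1) (l : K) (hl : l ∈ weights χ) (a : UW0 χ) :
    modelRep hp χ hχ l hl (incl χ a) (uvec K p 0) =
      character χ hχ l hl a • uvec K p 0 := by
  induction a using ReducedEnveloping.induction (span_range_e0 K p) with
  | halg r => simp [AlgHom.commutes]
  | hadd a b ha hb => rw [map_add, map_add, LinearMap.add_apply, ha, hb, map_add, add_smul]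
  | hmul a b ha hb =>
    rw [map_mul, map_mul, Module.End.mul_apply, hb, map_smul, ha, map_mul, smul_smul, mul_comm]
  | hι x hx =>
    obtain ⟨i, rfl⟩ := hx
    change modelRep hp χ hχ l hl (incl χ (eW0 χ i)) _ = character χ hχ l hl (eW0 χ i) • _
    rw [incl_eW0, modelRep_ι, character_eW0, modelOp_uvec_zero]

/-- The reduced Verma module is isomorphic to the model. -/
theorem exists_verma_equiv (hp : 3 < p) (χ : Module.Dual K (WittAlgebra K p))
    (hχ : height χ ≤ 1) (l : K) (hl : l ∈ weights χ) :
    ∃ f : verma χ hχ l hl ≃+ (Fin p → K),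
      ∀ (a : UW χ) v, f (a • v) = modelRep hp χ hχ l hl a (f v) := by
  let _ : Module (UW χ) (Fin p → K) :=
    Module.compHom _ (modelRep hp χ hχ l hl).toRingHom
  have hsmul : ∀ (a : UW χ) (x : Fin p → K), a • x = modelRep hp χ hχ l hl a x :=
    fun _ _ => rfl
  let φ := (incl χ).toRingHom
  let M := oneDim χ hχ l hl
  let V := verma χ hχ l hl
  let g : M →+ (Fin p → K) :=
    ((LinearMap.toSpanSingleton K (Fin p → K) (uvec K p 0)).toAddMonoidHom : K →+ (Fin p → K))
  have hg : ∀ (a : UW0 χ) (m : M), g (a • m) = φ a • g m := fun a m => by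
    change (character χ hχ l hl a * (show K from m)) • uvec K p 0 =
      modelRep hp χ hχ l hl (incl χ a) ((show K from m) • uvec K p 0)
    rw [map_smul, modelRep_incl_uvec_zero, smul_smul, mul_comm]
  let f : V →ₗ[UW χ] (Fin p → K) := inducedModule.lift φ M g hg
  let v : V := inducedModule.tmul φ M 1 (show K from 1)
  let _ : Module K V := ModuleCat.moduleOfAlgebraModule V
  have _ : IsScalarTower K (UW χ) V := ModuleCat.isScalarTower_of_algebra_moduleCat V
  have htmul : ∀ (b : UW χ) (a : UW0 χ),
      inducedModule.tmul φ M b (show K from character χ hχ l hl a) = (b * incl χ a) • v := by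
    intro b a
    have h1 := inducedModule.tmul_smul φ M b a (show K from 1)
    have h2 : (a • (show M from (show K from 1)) : M) = (show K from character χ hχ l hl a) :=
      mul_one (character χ hχ l hl a)
    rw [h2] at h1
    rw [h1]
    exact (congrArg (fun b => inducedModule.tmul φ M b (show K from 1)) (mul_one _)).symm
  have hv : ∀ i, ∃ c : K, eW χ (i + 1) • v = c • v := fun i => by
    refine ⟨character χ hχ l hl (eW0 χ i), ?_⟩
    have h1 := htmul 1 (eW0 χ i)
    have h2 := htmul 1 (algebraMap K _ (character χ hχ l hl (eW0 χ i)))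
    rw [AlgHom.commutes, Algebra.algebraMap_self_apply, h1, AlgHom.commutes, one_mul, one_mul,
      incl_eW0, algebraMap_smul] at h2
    exact h2
  have hspan : ∀ w : V, w ∈ Submodule.span K (Set.range fun k : Fin p => eW χ 0 ^ (k : ℕ) • v) := by
    intro w
    induction w using inducedModule.induction with
    | h0 => exact Submodule.zero_mem _
    | hadd x y hx hy => exact Submodule.add_mem _ hx hy
    | htmul b m =>
      have h1 := htmul b (algebraMap K _ (show K from m))
      rw [AlgHom.commutes, Algebra.algebraMap_self_apply] at h1
      have h2 := span_eW_zero_pow_smul χ hp v hv (b * incl χ (algebraMap K _ (show K from m)))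
      rw [← h1] at h2
      exact h2
  have hfK : ∀ (c : K) (w : V), f (c • w) = c • f w := fun c w => by
    rw [← algebraMap_smul (UW χ) c w, map_smul, hsmul, AlgHom.commutes,
      Module.algebraMap_end_apply]
  have hfv : f v = uvec K p 0 := by
    have h1 : f v = (1 : UW χ) • g (show K from 1) := inducedModule.lift_tmul φ M g hg 1 _
    rw [h1, one_smul]
    exact one_smul K _
  let d : Fin p → K := fun k => (-1) ^ (k : ℕ) * ((k : ℕ).factorial : K)
  have hd : ∀ k, d k ≠ 0 := fun k =>
    mul_ne_zero (pow_ne_zero _ (by simp)) (factorial_ne_zero_of_lt k.isLt)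
  have hfb : ∀ k : Fin p, f (eW χ 0 ^ (k : ℕ) • v) = d k • uvec K p k := fun k => by
    rw [map_smul, hfv, hsmul, map_pow, modelRep_ι, modelOp_zero_pow_uvec _ _ k.isLt]
  have hsum : ∀ c : Fin p → K,
      f (∑ k, c k • eW χ 0 ^ (k : ℕ) • v) = fun k => c k * d k := fun c => by
    rw [map_sum, eq_sum_uvec (fun k => c k * d k)]
    refine Finset.sum_congr rfl fun k _ => ?_
    rw [hfK, hfb, smul_smul]
  have hinj : Function.Injective f := by
    rw [injective_iff_map_eq_zero]
    intro w hw
    obtain ⟨c, rfl⟩ := (Submodule.mem_span_range_iff_exists_fun K).1 (hspan w)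
    rw [hsum] at hw
    refine Finset.sum_eq_zero fun k _ => ?_
    have : c k = 0 := (mul_eq_zero.1 (congrFun hw k)).resolve_right (hd k)
    rw [this, zero_smul]
  have hsurj : Function.Surjective f := fun x =>
    ⟨∑ k, (x k / d k) • eW χ 0 ^ (k : ℕ) • v, by
      rw [hsum]
      funext k
      exact div_mul_cancel₀ _ (hd k)⟩
  exact ⟨AddEquiv.ofBijective f.toAddMonoidHom ⟨hinj, hsurj⟩, fun a w => map_smul f a w⟩

end WittAlgebra

/-! ### `Ext¹` from a cyclic module -/

section ExtOne

open Abelian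

variable {K : Type u} [Field K] {A : Type u} [Ring A] [Algebra K A] {M : ModuleCat.{u} A}
  {q : A →ₗ[A] M} (hq : Function.Surjective q) (N : ModuleCat.{u} A)

variable (K) in
/-- The connecting map `Hom (ker q, N) → Ext¹ (M, N)` of a presentation `q : A → M`. -/
def extConnecting : (ModuleCat.of A (LinearMap.ker q) ⟶ N) →ₗ[K] Ext M N 1 :=
  ((LinearMap.shortExact_shortComplexKer hq).extClass.precompOfLinear K N (add_comm 1 0)).comp
    (Ext.linearEquiv₀ (R := K)).symm.toLinearMap

theorem extConnecting_surjective : Function.Surjective (extConnecting K hq N) := by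
  have h : Projective (LinearMap.shortComplexKer q).X₂ :=
    inferInstanceAs (Projective (ModuleCat.of A A))
  exact (precomp_extClass_surjective_of_projective_X₂ N
    (LinearMap.shortExact_shortComplexKer hq) 0).comp (Ext.linearEquiv₀ (R := K)).symm.surjective

theorem extConnecting_eq_zero_iff (φ : ModuleCat.of A (LinearMap.ker q) ⟶ N) :
    extConnecting K hq N φ = 0 ↔ ∃ n : N, ∀ x, φ.hom x = (x : A) • n := by
  have hS := LinearMap.shortExact_shortComplexKer hq
  have hδ : extConnecting K hq N φ = hS.extClass.comp (Ext.mk₀ φ) (add_comm 1 0) := rfl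
  rw [hδ]
  constructor
  · intro h
    obtain ⟨x₂, hx₂⟩ := Ext.contravariant_sequence_exact₁ hS N (Ext.mk₀ φ) (add_comm 1 0) h
    obtain ⟨ψ, rfl⟩ := (Ext.mk₀_bijective _ _).2 x₂
    rw [Ext.mk₀_comp_mk₀] at hx₂
    have hφ := (Ext.mk₀_bijective _ _).1 hx₂
    refine ⟨ψ.hom (1 : A), fun x => ?_⟩
    rw [← hφ]
    change ψ.hom (x : A) = _
    rw [← map_smul, smul_eq_mul, mul_one]
  · rintro ⟨n, hn⟩
    let ψ : (LinearMap.shortComplexKer q).X₂ ⟶ N :=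
      ModuleCat.ofHom (LinearMap.toSpanSingleton A N n)
    have hφ : φ = (LinearMap.shortComplexKer q).f ≫ ψ := by
      ext x
      exact hn x
    rw [hφ, ← Ext.mk₀_comp_mk₀]
    exact hS.extClass_comp_assoc _

theorem subsingleton_ext_one (K : Type u) [Field K] {A : Type u} [Ring A] [Algebra K A]
    {M : ModuleCat.{u} A} {q : A →ₗ[A] M} (hq : Function.Surjective q) (N : ModuleCat.{u} A)
    (h : ∀ φ : LinearMap.ker q →ₗ[A] N, ∃ n : N, ∀ x, φ x = (x : A) • n) :
    Subsingleton (Ext M N 1) := by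
  refine subsingleton_of_forall_eq 0 fun x => ?_
  obtain ⟨φ, rfl⟩ := extConnecting_surjective (K := K) hq N x
  exact (extConnecting_eq_zero_iff hq N φ).2 (h φ.hom)

/-- If a functional `φ ↦ f (φ x₀)` on `Hom (ker q, N)` is nonzero and its kernel consists of the
maps that extend to `A`, then `Ext¹ (M, N)` is one-dimensional. -/
theorem nonempty_ext_one_equiv {q : A →ₗ[A] M} (hq : Function.Surjective q)
    (N : ModuleCat.{u} A) (f : N →+ K) (hf : ∀ (r : K) n, f (algebraMap K A r • n) = r * f n)
    (x₀ : LinearMap.ker q)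
    (h : ∀ φ : LinearMap.ker q →ₗ[A] N, f (φ x₀) = 0 → ∃ n : N, ∀ x, φ x = (x : A) • n)
    (h' : ∀ n : N, f ((x₀ : A) • n) = 0)
    (h₁ : ∃ φ : LinearMap.ker q →ₗ[A] N, f (φ x₀) ≠ 0) :
    Nonempty (Ext M N 1 ≃ₗ[K] K) := by
  let F : (ModuleCat.of A (LinearMap.ker q) ⟶ N) →ₗ[K] K :=
    { toFun := fun φ => f (φ.hom x₀)
      map_add' := fun φ ψ => map_add f _ _
      map_smul' := fun r φ => hf r _ }
  have hF : Function.Surjective F := by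
    obtain ⟨φ, hφ⟩ := h₁
    refine LinearMap.surjective fun h0 => hφ ?_
    exact LinearMap.congr_fun h0 (ModuleCat.ofHom φ)
  have hker : LinearMap.ker (extConnecting K hq N) = LinearMap.ker F := by
    ext φ
    rw [LinearMap.mem_ker, LinearMap.mem_ker, extConnecting_eq_zero_iff]
    constructor
    · rintro ⟨n, hn⟩
      change f (φ.hom x₀) = 0
      rw [hn, h']
    · exact h φ.hom
  exact ⟨((LinearMap.quotKerEquivOfSurjective _ (extConnecting_surjective hq N)).symm.trans
    (Submodule.quotEquivOfEq _ _ hker)).trans (LinearMap.quotKerEquivOfSurjective _ hF)⟩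

end ExtOne

/-! ### The recursion satisfied by the coefficients of a cocycle -/

namespace WittAlgebra

variable {K : Type u} [Field K] {p : ℕ}

/-- The cocycle identity for a family `c`, where `c i` is the coefficient of `e_i ↦ c i • u_{p-i}`.
The identities with `i + j ≥ p - 1` are included; for an actual cocycle `c (p - 1) = c p = 0`. -/
def IsCocycleCoeff (p : ℕ) (l : K) (c : ℕ → K) : Prop :=
  ∀ i j, 1 ≤ i → 1 ≤ j → i + j ≤ p →
    ((i + 1 : K) * l + i + j) * c j - ((j + 1 : K) * l + i + j) * c i = ((j : K) - i) * c (i + j)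

theorem natCast_ne_zero_of_lt [CharP K p] {n : ℕ} (h0 : 0 < n) (h : n < p) : (n : K) ≠ 0 := by
  rw [Ne, CharP.cast_eq_zero_iff K p]
  exact Nat.not_dvd_of_pos_of_lt h0 h

namespace IsCocycleCoeff

variable {l : K} {c : ℕ → K}

theorem succ_eq (h : IsCocycleCoeff p l c) (h1 : c 1 = 0) {j : ℕ} (hj : 1 ≤ j) (hjp : j + 1 ≤ p) :
    (2 * l + 1 + j) * c j = ((j : K) - 1) * c (j + 1) := by
  have := h 1 j le_rfl hj (by omega)
  rw [h1, add_comm 1 j] at this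
  push_cast at this
  linear_combination this

variable [CharP K p]

theorem eq_zero_of_apply_two (h : IsCocycleCoeff p l c) (h1 : c 1 = 0) (h2 : c 2 = 0) {j : ℕ}
    (hj : 2 ≤ j) (hjp : j ≤ p) : c j = 0 := by
  induction j, hj using Nat.le_induction with
  | base => exact h2
  | succ j hj ih =>
    have := h.succ_eq h1 (by omega) hjp
    rw [ih (by omega), mul_zero, eq_comm] at this
    refine (mul_eq_zero.1 this).resolve_left ?_
    have := natCast_ne_zero_of_lt (K := K) (p := p) (n := j - 1) (by omega) (by omega)
    rwa [Nat.cast_sub (by omega), Nat.cast_one] at this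

variable [Fact p.Prime]

/-- The value `c 5` can be computed from the pairs `(1, 4)` and `(2, 3)`. -/
theorem mul_apply_two_eq_zero (h : IsCocycleCoeff p l c) (hp : 3 < p) (h1 : c 1 = 0) :
    l * (2 * l + 1) * (l + 1) * c 2 = 0 := by
  have hp5 : 5 ≤ p := by
    by_contra hlt
    obtain rfl : p = 4 := by omega
    exact absurd (Fact.out : Nat.Prime 4) (by norm_num)
  have h12 := h 1 2 le_rfl (by omega) (by omega)
  have h13 := h 1 3 le_rfl (by omega) (by omega)
  have h14 := h 1 4 le_rfl (by omega) (by omega)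
  have h23 := h 2 3 (by omega) (by omega) (by omega)
  have h2 : (2 : K) ≠ 0 := natCast_ne_zero_of_lt (p := p) (n := 2) (by omega) (by omega)
  norm_num [h1] at h12 h13 h14 h23
  have h4 : (4 : K) * (l * (2 * l + 1) * (l + 1) * c 2) = 0 := by
    rw [← h12] at h13 h23
    linear_combination 2 * h14 - 6 * h23 + (2 * l + 5) * h13
  exact (mul_eq_zero.1 h4).resolve_left (by
    rw [show (4 : K) = 2 * 2 by norm_num]; exact mul_ne_zero h2 h2)

theorem eq_zero (h : IsCocycleCoeff p l c) (hp : 3 < p) (h1 : c 1 = 0) (hlast : c (p - 1) = 0)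
    {j : ℕ} (hj : 1 ≤ j) (hjp : j ≤ p) : c j = 0 := by
  have h2 : c 2 = 0 := by
    by_contra h2
    -- `2 l + 1` is `0`, `1` or `-1`, so the recursion can be run downwards from `p - 1` to `2`
    have hs : ∀ k : ℕ, 2 ≤ k → k + 1 ≤ p - 1 → 2 * l + 1 + k ≠ 0 := by
      intro k hk hkp
      have hm := natCast_ne_zero_of_lt (K := K) (p := p) (n := k - 1) (by omega) (by omega)
      have h0 := natCast_ne_zero_of_lt (K := K) (p := p) (n := k) (by omega) (by omega)
      have h1 := natCast_ne_zero_of_lt (K := K) (p := p) (n := k + 1) (by omega) (by omega)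
      rw [Nat.cast_sub (by omega), Nat.cast_one] at hm
      rw [Nat.cast_add, Nat.cast_one] at h1
      rcases mul_eq_zero.1 ((mul_eq_zero.1 (h.mul_apply_two_eq_zero hp ‹c 1 = 0›)).resolve_right h2)
        with hl | hl
      · rcases mul_eq_zero.1 hl with hl | hl
        · rw [hl]
          intro h'
          exact h1 (by linear_combination h')
        · rw [hl, zero_add]
          exact h0
      · intro h'
        exact hm (by linear_combination h' - 2 * hl)
    have hdown : ∀ d, d + 2 ≤ p - 1 → c (p - 1 - d) = 0 := by
      intro d
      induction d with
      | zero => intro _; exact hlast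
      | succ d ih =>
        intro hd
        have := h.succ_eq h1 (show 1 ≤ p - 1 - (d + 1) by omega) (by omega)
        rw [show p - 1 - (d + 1) + 1 = p - 1 - d by omega, ih (by omega), mul_zero] at this
        exact (mul_eq_zero.1 this).resolve_left (hs _ (by omega) (by omega))
    exact h2 (by simpa [show p - 1 - (p - 3) = 2 by omega] using hdown (p - 3) (by omega))
  rcases (by omega : j = 1 ∨ 2 ≤ j) with rfl | hj
  · exact h1
  · exact h.eq_zero_of_apply_two h1 h2 hj hjp

/-- The family `(i + 1) l + i` satisfies all identities (formally it is the coboundary of `u_p`),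
and its value at `p - 1` is `-1`. Subtracting a multiple of it makes `c 1` vanish. -/
theorem apply_one_eq_zero (h : IsCocycleCoeff p l c) (hp : 3 < p) (hl0 : l ≠ 0) (hl1 : l + 1 ≠ 0)
    (hl2 : 2 * l + 1 ≠ 0) (hlast : c (p - 1) = 0) : c 1 = 0 := by
  set t := c 1 / (2 * l + 1) with ht
  have h' : IsCocycleCoeff p l fun i => c i - t * ((i + 1 : K) * l + i) := by
    intro i j hi hj hij
    have := h i j hi hj hij
    simp only
    push_cast
    linear_combination this
  have h1 : c 1 - t * (((1 : ℕ) + 1 : K) * l + (1 : ℕ)) = 0 := by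
    rw [ht]
    field_simp
    push_cast
    ring
  have h2 := (mul_eq_zero.1 (h'.mul_apply_two_eq_zero hp h1)).resolve_left
    (mul_ne_zero (mul_ne_zero hl0 hl2) hl1)
  have h3 := h'.eq_zero_of_apply_two h1 h2 (show 2 ≤ p - 1 by omega) (by omega)
  simp only [hlast, Nat.cast_sub (show 1 ≤ p by omega), CharP.cast_eq_zero] at h3
  have ht0 : t = 0 := by
    push_cast at h3
    linear_combination h3
  rw [ht0, zero_mul, sub_zero] at h1
  exact h1

end IsCocycleCoeff

end WittAlgebra

/-! ### Cocycles with values in the model -/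

namespace WittAlgebra

attribute [local instance 100] LieRing.ofAssociativeRing

variable {K : Type u} [Field K] {p : ℕ}

theorem hat_modelOp_two_pow [CharP K p] (t l : K) (j : ℕ) (x : Fin p → K) (k : ℕ) :
    hat ((modelOp t l 2 ^ j) x) k =
      (∏ s ∈ Finset.range j, (2 * l - (k + s : ℕ))) * hat x (k + j) := by
  induction j generalizing k with
  | zero => simp
  | succ j ih =>
    rw [pow_succ', Module.End.mul_apply, hat_modelOp_of_pos _ _ (by omega), ih,
      Finset.prod_range_succ']
    rw [show k + 2 - 1 = k + 1 by omega, show k + 1 + j = k + (j + 1) by ring]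
    simp only [show ∀ s, k + 1 + s = k + (s + 1) from fun s => by ring]
    push_cast
    ring

variable [Fact p.Prime] [CharP K p]

/-- The presentation `a ↦ a • 1` of the one-dimensional module. -/
def oneDimPres (χ : Module.Dual K (WittAlgebra K p)) (hχ : height χ ≤ 1) (l : K)
    (hl : l ∈ weights χ) : UW0 χ →ₗ[UW0 χ] oneDim χ hχ l hl :=
  LinearMap.toSpanSingleton (UW0 χ) (oneDim χ hχ l hl) (show K from 1)

section

variable {χ : Module.Dual K (WittAlgebra K p)} {hχ : height χ ≤ 1} {l : K} {hl : l ∈ weights χ}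

theorem oneDimPres_apply (a : UW0 χ) :
    oneDimPres χ hχ l hl a = (show K from character χ hχ l hl a) :=
  mul_one (character χ hχ l hl a)

theorem oneDimPres_surjective : Function.Surjective (oneDimPres χ hχ l hl) := fun c =>
  ⟨algebraMap K _ (show K from c), by
    rw [oneDimPres_apply, AlgHom.commutes, Algebra.algebraMap_self_apply]⟩

theorem mem_ker_oneDimPres {a : UW0 χ} :
    a ∈ LinearMap.ker (oneDimPres χ hχ l hl) ↔ character χ hχ l hl a = 0 := by
  rw [LinearMap.mem_ker, oneDimPres_apply]
  exact Iff.rfl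

variable (hχ hl) in
/-- The generators `e_0 - l` and `e_i`, for `i ≥ 1`, of the augmentation ideal. -/
def augGen (i : ℕ) : LinearMap.ker (oneDimPres χ hχ l hl) :=
  ⟨eW0 χ i - algebraMap K _ (if i = 0 then l else 0), by
    rw [mem_ker_oneDimPres, map_sub, character_eW0, AlgHom.commutes, Algebra.algebraMap_self_apply,
      sub_self]⟩

theorem coe_augGen_zero : (augGen hχ hl 0 : UW0 χ) = eW0 χ 0 - algebraMap K _ l := rfl

theorem coe_augGen {i : ℕ} (hi : 1 ≤ i) : (augGen hχ hl i : UW0 χ) = eW0 χ i := by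
  rw [augGen]
  simp only
  rw [if_neg (by omega), map_zero, sub_zero]

/-- An equivariant map from the augmentation ideal to the model, in other words a 1-cocycle. -/
structure ModelCocycle (hp : 3 < p) (χ : Module.Dual K (WittAlgebra K p)) (hχ : height χ ≤ 1)
    (l : K) (hl : l ∈ weights χ) where
  /-- the underlying additive map -/
  toFun : LinearMap.ker (oneDimPres χ hχ l hl) →+ (Fin p → K)
  map_smul : ∀ (a : UW0 χ) x, toFun (a • x) = modelRep hp χ hχ l hl (incl χ a) (toFun x)

variable {hp : 3 < p}

theorem modelRep_incl_eW0 (i : ℕ) : modelRep hp χ hχ l hl (incl χ (eW0 χ i)) =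
    modelOp (χ (e K p (-1)) ^ p) l (i + 1) := by
  rw [incl_eW0, modelRep_ι]

theorem modelRep_incl_algebraMap (r : K) (x : Fin p → K) :
    modelRep hp χ hχ l hl (incl χ (algebraMap K _ r)) x = r • x := by
  rw [AlgHom.commutes, AlgHom.commutes, Module.algebraMap_end_apply]

theorem eW0_mul_sub (i j : ℕ) :
    eW0 χ i * eW0 χ j - eW0 χ j * eW0 χ i = algebraMap K _ ((j : K) - i) * eW0 χ (i + j) := by
  rw [← LieRing.of_associative_ring_bracket, ← LieHom.map_lie, ← Algebra.smul_def, ← map_smul]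
  congr 1
  apply Subtype.ext
  change ⁅e K p (i : ℤ), e K p (j : ℤ)⁆ = ((j : K) - i) • e K p ((i + j : ℕ) : ℤ)
  rw [lie_e _ _ (by omega) (by omega)]
  push_cast
  rfl

theorem eW0_eq_zero {i : ℕ} (hi : p ≤ i + 1) : eW0 χ i = 0 := by
  have : e0 K p i = 0 := Subtype.ext (e_eq_zero (by omega))
  rw [eW0, this, map_zero]

theorem pMap0_e0 (hp : 3 < p) (i : ℕ) : pMap0 K p (e0 K p i) = if i = 0 then e0 K p i else 0 := by
  apply Subtype.ext
  have h := pMap_e_nat (K := K) hp (i + 1)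
  rw [show ((i + 1 : ℕ) : ℤ) - 1 = i by push_cast; ring] at h
  change pMap K p (e K p i) = _
  rw [h]
  by_cases hi : i = 0
  · simp [hi, coe_e0]
  · simp [hi]

theorem eW0_zero_pow (hp : 3 < p) (hl : l ∈ weights χ) :
    eW0 χ 0 ^ p = eW0 χ 0 + algebraMap K _ (l ^ p - l) := by
  rw [eW0, ReducedEnveloping.ι_pow, pMap0_e0 hp, if_pos rfl, show l ^ p - l = _ from hl]
  rfl

theorem eW0_pow (hp : 3 < p) (hχ : height χ ≤ 1) {i : ℕ} (hi : 1 ≤ i) : eW0 χ i ^ p = 0 := by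
  rw [eW0, ReducedEnveloping.ι_pow, pMap0_e0 hp, if_neg (by omega), map_zero, zero_add]
  have h := apply_e_of_height_le_one hχ (m := i + 1) (by omega)
  rw [show ((i + 1 : ℕ) : ℤ) - 1 = i by push_cast; ring] at h
  change algebraMap K _ (χ (e K p i) ^ p) = 0
  rw [h, zero_pow (Fact.out : p.Prime).ne_zero, map_zero]

namespace ModelCocycle

/-- The augmentation ideal is generated by `e_0 - l` and the `e_i` with `i ≥ 1`. -/
theorem eq_zero_of_augGen (φ : ModelCocycle hp χ hχ l hl)
    (h : ∀ i, φ.toFun (augGen hχ hl i) = 0) (x) : φ.toFun x = 0 := by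
  have hmem : ∀ a : UW0 χ, a - algebraMap K _ (character χ hχ l hl a) ∈
      LinearMap.ker (oneDimPres χ hχ l hl) := fun a => by
    rw [mem_ker_oneDimPres, map_sub, AlgHom.commutes, Algebra.algebraMap_self_apply, sub_self]
  have key : ∀ a : UW0 χ, φ.toFun ⟨_, hmem a⟩ = 0 := fun a => by
    induction a using ReducedEnveloping.induction (span_range_e0 K p) with
    | halg r =>
      convert map_zero φ.toFun
      rw [AlgHom.commutes, Algebra.algebraMap_self_apply, sub_self]
      rfl
    | hadd a b ha hb =>
      rw [← add_zero (0 : Fin p → K)]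
      nth_rewrite 1 [← ha]
      rw [← hb, ← map_add]
      congr 1
      apply Subtype.ext
      simp only [Submodule.coe_add, map_add]
      abel
    | hmul a b ha hb =>
      have h1 : (⟨_, hmem (a * b)⟩ : LinearMap.ker (oneDimPres χ hχ l hl)) =
          a • ⟨_, hmem b⟩ + algebraMap K (UW0 χ) (character χ hχ l hl b) • ⟨_, hmem a⟩ := by
        apply Subtype.ext
        simp only [Submodule.coe_add, Submodule.coe_smul, smul_eq_mul, map_mul]
        rw [mul_sub, mul_sub, Algebra.commutes (character χ hχ l hl b) a,
          Algebra.commutes (character χ hχ l hl b) (algebraMap K (UW0 χ) _)]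
        abel
      rw [h1, map_add, φ.map_smul, φ.map_smul, ha, hb, map_zero, map_zero, add_zero]
    | hι x hx =>
      obtain ⟨i, rfl⟩ := hx
      rw [← h i]
      congr 1
      apply Subtype.ext
      change eW0 χ i - algebraMap K _ (character χ hχ l hl (eW0 χ i)) = _
      rw [character_eW0]
      rfl
  rw [← key x]
  congr 1
  apply Subtype.ext
  simp only
  rw [mem_ker_oneDimPres.1 x.2, map_zero, sub_zero]

theorem lie_eq (φ : ModelCocycle hp χ hχ l hl) {i j : ℕ} (hi : 1 ≤ i) (hj : 1 ≤ j) :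
    modelOp (χ (e K p (-1)) ^ p) l (i + 1) (φ.toFun (augGen hχ hl j)) -
      modelOp (χ (e K p (-1)) ^ p) l (j + 1) (φ.toFun (augGen hχ hl i)) =
      ((j : K) - i) • φ.toFun (augGen hχ hl (i + j)) := by
  rw [← modelRep_incl_eW0 (hp := hp) (hχ := hχ) (hl := hl),
    ← modelRep_incl_eW0 (hp := hp) (hχ := hχ) (hl := hl), ← φ.map_smul, ← φ.map_smul,
    ← modelRep_incl_algebraMap (hp := hp) (hχ := hχ) (hl := hl), ← φ.map_smul, ← map_sub]
  congr 1
  apply Subtype.ext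
  simp only [Submodule.coe_sub, Submodule.coe_smul, smul_eq_mul]
  rw [coe_augGen hi, coe_augGen hj, coe_augGen (by omega), eW0_mul_sub]

theorem weight_eq (φ : ModelCocycle hp χ hχ l hl) {j : ℕ} (hj : 1 ≤ j) :
    modelOp (χ (e K p (-1)) ^ p) l 1 (φ.toFun (augGen hχ hl j)) =
      modelOp (χ (e K p (-1)) ^ p) l (j + 1) (φ.toFun (augGen hχ hl 0)) +
      (l + j) • φ.toFun (augGen hχ hl j) := by
  rw [← modelRep_incl_eW0 (hp := hp) (hχ := hχ) (hl := hl),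
    ← modelRep_incl_eW0 (hp := hp) (hχ := hχ) (hl := hl), ← φ.map_smul, ← φ.map_smul,
    ← modelRep_incl_algebraMap (hp := hp) (hχ := hχ) (hl := hl), ← φ.map_smul, ← map_add]
  congr 1
  apply Subtype.ext
  simp only [Submodule.coe_add, Submodule.coe_smul, smul_eq_mul]
  have h := eW0_mul_sub (χ := χ) 0 j
  rw [coe_augGen hj, coe_augGen_zero, sub_eq_iff_eq_add.1 h, mul_sub, map_add, add_mul,
    Algebra.commutes l]
  simp only [Nat.cast_zero, sub_zero, Nat.zero_add]
  abel

/-- With `y = e_0 - l` one has `(y ^ (p - 1) - 1) y = 0`, and `y` kills `u_0`. -/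
theorem hat_augGen_zero (φ : ModelCocycle hp χ hχ l hl) :
    hat (φ.toFun (augGen hχ hl 0)) 0 = 0 := by
  have hp0 := (Fact.out : p.Prime).one_lt
  have hnt : Nontrivial (UW0 χ) := (character χ hχ l hl).toRingHom.domain_nontrivial
  have hchar : CharP (UW0 χ) p := charP_of_injective_algebraMap (algebraMap K _).injective p
  have h1 : ((eW0 χ 0 - algebraMap K _ l) ^ (p - 1) - 1) • augGen hχ hl 0 = 0 := by
    apply Subtype.ext
    simp only [Submodule.coe_smul, smul_eq_mul, coe_augGen_zero, Submodule.coe_zero]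
    rw [sub_mul, one_mul, ← pow_succ, Nat.sub_add_cancel hp0.le,
      sub_pow_char_of_commute _ (Algebra.commutes l _).symm, eW0_zero_pow hp hl, map_sub, map_pow]
    abel
  have hy : modelRep hp χ hχ l hl (incl χ (eW0 χ 0 - algebraMap K _ l)) =
      modelOp (χ (e K p (-1)) ^ p) l 1 - algebraMap K _ l := by
    rw [map_sub, map_sub, modelRep_incl_eW0, AlgHom.commutes, AlgHom.commutes]
  have h2 := congrArg φ.toFun h1
  rw [φ.map_smul, map_zero, map_sub (incl χ), map_sub (modelRep hp χ hχ l hl), map_one, map_one,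
    map_pow, map_pow, hy, LinearMap.sub_apply, Module.End.one_apply] at h2
  obtain ⟨q, hq⟩ : ∃ q, p - 1 = q + 1 := ⟨p - 2, by omega⟩
  have h3 := congrArg (fun x => hat x 0) h2
  rw [hq, pow_succ', Module.End.mul_apply, LinearMap.sub_apply] at h3
  simp only [hat_sub, hat_zero] at h3
  rw [hat_modelOp_of_pos _ _ (by omega), Module.algebraMap_end_apply, hat_smul] at h3
  simp at h3
  exact h3

variable (hχ hl hp) in
/-- The coboundary `x ↦ x v` of a vector `v` of the model. -/
def coboundary (v : Fin p → K) : LinearMap.ker (oneDimPres χ hχ l hl) →+ (Fin p → K) where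
  toFun x := modelRep hp χ hχ l hl (incl χ x) v
  map_zero' := by simp
  map_add' x y := by simp

/-- Subtraction of a coboundary. -/
def subCoboundary (φ : ModelCocycle hp χ hχ l hl) (v : Fin p → K) : ModelCocycle hp χ hχ l hl where
  toFun := φ.toFun - coboundary hχ hl hp v
  map_smul a x := by
    have h : coboundary hχ hl hp v (a • x) =
        modelRep hp χ hχ l hl (incl χ a) (coboundary hχ hl hp v x) := by
      change modelRep hp χ hχ l hl (incl χ (a * x)) v = _
      rw [map_mul, map_mul]
      rfl
    rw [AddMonoidHom.sub_apply, AddMonoidHom.sub_apply, φ.map_smul, h, map_sub]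

theorem subCoboundary_apply (φ : ModelCocycle hp χ hχ l hl) (v : Fin p → K) (x) :
    (φ.subCoboundary v).toFun x = φ.toFun x - modelRep hp χ hχ l hl (incl χ x) v := rfl

/-- Every cocycle is cohomologous to one that vanishes at `e_0 - l`: the weights `l - k` of the
model are distinct, so `e_0 - l` is invertible away from `u_0`. -/
theorem exists_subCoboundary (φ : ModelCocycle hp χ hχ l hl) :
    ∃ v, (φ.subCoboundary v).toFun (augGen hχ hl 0) = 0 := by
  refine ⟨fun k => -(hat (φ.toFun (augGen hχ hl 0)) k) / ((k : ℕ) : K), ?_⟩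
  set v : Fin p → K := fun k => -(hat (φ.toFun (augGen hχ hl 0)) k) / ((k : ℕ) : K) with hv
  rw [subCoboundary_apply, coe_augGen_zero, map_sub, map_sub, modelRep_incl_eW0,
    LinearMap.sub_apply, modelRep_incl_algebraMap]
  refine hat_ext fun k => ?_
  rw [hat_sub, hat_sub, hat_smul, hat_zero, hat_modelOp_of_pos _ _ (by omega)]
  by_cases hk : k < p
  · have hvk : hat v k = -(hat (φ.toFun (augGen hχ hl 0)) k) / (k : K) := dif_pos hk
    rcases Nat.eq_zero_or_pos k with rfl | hk0
    · rw [φ.hat_augGen_zero]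
      simp
    · have := natCast_ne_zero_of_lt (K := K) (p := p) hk0 hk
      simp only [Nat.zero_add, Nat.add_sub_cancel, hvk]
      field_simp
      push_cast
      ring
  · rw [hat_of_le _ (by omega), hat_of_le _ (by omega), hat_of_le _ (by omega)]
    simp

/-- The coefficient `c i` in `e_i ↦ c i • u_{p-i}`. -/
def coeff (φ : ModelCocycle hp χ hχ l hl) (i : ℕ) : K := hat (φ.toFun (augGen hχ hl i)) (p - i)

theorem hat_augGen (φ : ModelCocycle hp χ hχ l hl) (h0 : φ.toFun (augGen hχ hl 0) = 0) {i : ℕ}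
    (hi : 1 ≤ i) (hip : i < p) {k : ℕ} (hk : k + i ≠ p) :
    hat (φ.toFun (augGen hχ hl i)) k = 0 := by
  by_cases hkp : k < p
  · have h := congrArg (fun x => hat x k) (φ.weight_eq hi)
    rw [h0, map_zero, zero_add] at h
    simp only [hat_smul] at h
    rw [hat_modelOp_of_pos _ _ le_rfl, Nat.add_sub_cancel] at h
    have h1 : ((k + i : ℕ) : K) ≠ 0 := by
      rw [Ne, CharP.cast_eq_zero_iff K p]
      rintro ⟨d, hd⟩
      have h2 : d < 2 := by
        by_contra hd2
        have : p * 2 ≤ p * d := Nat.mul_le_mul_left p (by omega)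
        omega
      interval_cases d <;> omega
    refine (mul_eq_zero.1 (?_ : ((k + i : ℕ) : K) * _ = 0)).resolve_left h1
    push_cast at h ⊢
    linear_combination -h
  · exact hat_of_le _ (by omega)

theorem augGen_eq_zero (φ : ModelCocycle hp χ hχ l hl) {i : ℕ} (hi : p ≤ i + 1) :
    φ.toFun (augGen hχ hl i) = 0 := by
  convert map_zero φ.toFun
  apply Subtype.ext
  rw [coe_augGen (by omega), eW0_eq_zero hi]
  rfl

theorem isCocycleCoeff (φ : ModelCocycle hp χ hχ l hl) : IsCocycleCoeff p l φ.coeff := by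
  intro i j hi hj hij
  have h := congrArg (fun x => hat x (p - (i + j))) (φ.lie_eq hi hj)
  simp only [hat_sub, hat_smul] at h
  rw [hat_modelOp_of_pos _ _ (by omega), hat_modelOp_of_pos _ _ (by omega),
    show p - (i + j) + (i + 1) - 1 = p - j by omega,
    show p - (i + j) + (j + 1) - 1 = p - i by omega, Nat.cast_sub hij, CharP.cast_eq_zero K p] at h
  unfold coeff
  push_cast at h
  linear_combination h

theorem eq_zero (φ : ModelCocycle hp χ hχ l hl) (h0 : φ.toFun (augGen hχ hl 0) = 0)
    (h1 : φ.coeff 1 = 0) (x) : φ.toFun x = 0 := by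
  have hlast : φ.coeff (p - 1) = 0 := by
    rw [coeff, φ.augGen_eq_zero (by omega), hat_zero]
  refine φ.eq_zero_of_augGen (fun i => ?_) x
  rcases (by omega : i = 0 ∨ p ≤ i + 1 ∨ (1 ≤ i ∧ i < p)) with rfl | hi | ⟨hi, hip⟩
  · exact h0
  · exact φ.augGen_eq_zero hi
  · refine hat_ext fun k => ?_
    rw [hat_zero]
    by_cases hk : k + i = p
    · have := φ.isCocycleCoeff.eq_zero hp h1 hlast hi (by omega)
      rwa [coeff, show p - i = k by omega] at this
    · exact φ.hat_augGen h0 hi hip hk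

/-- For `l = -1/2` the relation `e_1 ^ p = 0` is an obstruction, as `e_1 ^ (p - 1)` takes `u_{p-1}`
to a nonzero multiple of `u_0`. -/
theorem coeff_one_eq_zero_of_half (φ : ModelCocycle hp χ hχ l hl) (h2 : 2 * l + 1 = 0) :
    φ.coeff 1 = 0 := by
  have hp0 := (Fact.out : p.Prime).one_lt
  have h1 : eW0 χ 1 ^ (p - 1) • augGen hχ hl 1 = 0 := by
    apply Subtype.ext
    simp only [Submodule.coe_smul, smul_eq_mul, Submodule.coe_zero]
    rw [coe_augGen le_rfl, ← pow_succ, Nat.sub_add_cancel hp0.le, eW0_pow hp hχ le_rfl]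
  have h3 := congrArg φ.toFun h1
  rw [φ.map_smul, map_pow, map_pow, modelRep_incl_eW0, map_zero] at h3
  have h4 := congrArg (fun x => hat x 0) h3
  simp only [hat_zero] at h4
  rw [hat_modelOp_two_pow, Nat.zero_add] at h4
  refine (mul_eq_zero.1 h4).resolve_left (Finset.prod_ne_zero_iff.2 fun s hs => ?_)
  have hs := Finset.mem_range.1 hs
  have := natCast_ne_zero_of_lt (K := K) (p := p) (n := s + 1) (by omega) (by omega)
  intro h'
  apply this
  push_cast at h' ⊢
  linear_combination h2 - h'

theorem coeff_one_eq_zero (φ : ModelCocycle hp χ hχ l hl) (hl0 : l ≠ 0) (hl1 : l + 1 ≠ 0) :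
    φ.coeff 1 = 0 := by
  by_cases h2 : 2 * l + 1 = 0
  · exact φ.coeff_one_eq_zero_of_half h2
  · refine φ.isCocycleCoeff.apply_one_eq_zero hp hl0 hl1 h2 ?_
    rw [coeff, φ.augGen_eq_zero (by omega), hat_zero]

theorem coboundary_coeff_one (v : Fin p → K) :
    hat (modelRep hp χ hχ l hl (incl χ (augGen hχ hl 1)) v) (p - 1) = 0 := by
  rw [coe_augGen le_rfl, modelRep_incl_eW0, hat_modelOp_of_pos _ _ (by omega),
    hat_of_le v (by omega), mul_zero]

theorem coeff_one_subCoboundary (φ : ModelCocycle hp χ hχ l hl) (v : Fin p → K) :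
    (φ.subCoboundary v).coeff 1 = φ.coeff 1 := by
  rw [coeff, subCoboundary_apply, hat_sub, coboundary_coeff_one, sub_zero]
  rfl

/-- A cocycle is a coboundary as soon as its coefficient at `e_1` vanishes. -/
theorem exists_eq_coboundary (φ : ModelCocycle hp χ hχ l hl) (h : φ.coeff 1 = 0) :
    ∃ v, ∀ x, φ.toFun x = modelRep hp χ hχ l hl (incl χ x) v := by
  obtain ⟨v, hv⟩ := φ.exists_subCoboundary
  refine ⟨v, fun x => ?_⟩
  have := (φ.subCoboundary v).eq_zero hv (by rw [coeff_one_subCoboundary, h]) x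
  rwa [subCoboundary_apply, sub_eq_zero] at this

end ModelCocycle

end

end WittAlgebra

/-! ### The nontrivial extensions for `l = 0` and `l = -1` -/

namespace WittAlgebra

attribute [local instance 100] LieRing.ofAssociativeRing

variable {K : Type u} [Field K] {p : ℕ}

variable (p) in
/-- The vector `c m • u_{p+1-m}`, which is zero for `m = 0` and for `m > p + 1`. -/
def extVec (c : ℕ → K) (m : ℕ) : Fin p → K := fun k => if (k : ℕ) + m = p + 1 then c m else 0

theorem hat_extVec (c : ℕ → K) (m k : ℕ) :
    hat (extVec p c m) k = if k + m = p + 1 ∧ k < p then c m else 0 := by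
  unfold hat extVec
  by_cases h : k < p <;> simp [h]

/-- The action of `e_{m-1}`, for `m ≥ 1`, on an extension of the one-dimensional module, spanned by
a vector `w`, by the model: `e_{m-1} w = c m • u_{p+1-m}` for `m ≥ 2` and `e_0 w = l w`. -/
def extOp (c : ℕ → K) (t l : K) (m : ℕ) : Module.End K ((Fin p → K) × K) where
  toFun x := (modelOp t l m x.1 + x.2 • extVec p c m, if m = 1 then l * x.2 else 0)
  map_add' x y := by
    refine Prod.ext ?_ ?_
    · simp only [Prod.fst_add, Prod.snd_add, map_add, add_smul]; abel
    · simp only [Prod.snd_add]; split_ifs <;> ring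
  map_smul' r x := by
    refine Prod.ext ?_ ?_
    · simp only [Prod.smul_fst, Prod.smul_snd, map_smul, smul_add, smul_smul, smul_eq_mul,
        RingHom.id_apply]
    · simp only [Prod.smul_snd, smul_eq_mul, RingHom.id_apply]; split_ifs <;> ring

theorem extOp_apply (c : ℕ → K) (t l : K) (m : ℕ) (x : Fin p → K) (s : K) :
    extOp c t l m (x, s) = (modelOp t l m x + s • extVec p c m, if m = 1 then l * s else 0) := rfl

/-- The conditions on `c` under which the operators `extOp c t l m` define a module. -/
structure IsExtData (p : ℕ) (l : K) (c : ℕ → K) : Prop where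
  apply_one : c 1 = 0
  apply_p : c p = 0
  apply_p_succ : c (p + 1) = 0
  cocycle : ∀ m n : ℕ, 2 ≤ m → 2 ≤ n →
    ((m : K) * l + m + n - 2) * c n - ((n : K) * l + m + n - 2) * c m =
      ((n : K) - m) * c (m + n - 1)
  pow_eq_zero : ∀ t, (modelOp t l 2 ^ (p - 1)) (uvec K p (p - 1)) = 0

theorem extVec_one {l : K} {c : ℕ → K} (h : IsExtData p l c) :
    extVec p c 1 = 0 := hat_ext fun k => by
  rw [hat_extVec, hat_zero, h.apply_one, ite_self]

theorem isExtData_zero [CharP K p] (hp : 3 < p) :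
    IsExtData p (0 : K) fun m => ((m : K) - 1) * m where
  apply_one := by simp
  apply_p := by simp
  apply_p_succ := by simp
  cocycle m n hm hn := by
    rw [Nat.cast_sub (by omega)]
    push_cast
    ring
  pow_eq_zero t := hat_ext fun k => by
    rw [hat_modelOp_two_pow, hat_uvec, hat_zero]
    rcases Nat.eq_zero_or_pos k with rfl | hk
    · rw [Finset.prod_eq_zero (i := 0) (Finset.mem_range.2 (by omega)) (by simp), zero_mul]
    · rw [if_neg (by omega), mul_zero]

theorem isExtData_neg_one [CharP K p] (hp : 3 < p) :
    IsExtData p (-1 : K) fun m => if m = 2 then 1 else 0 where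
  apply_one := by simp
  apply_p := if_neg (by omega)
  apply_p_succ := if_neg (by omega)
  cocycle m n hm hn := by
    rw [if_neg (show m + n - 1 ≠ 2 by omega)]
    split_ifs with h1 h2 h2
    · subst h1; subst h2; ring
    · subst h1; push_cast; ring
    · subst h2; push_cast; ring
    · ring
  pow_eq_zero t := hat_ext fun k => by
    rw [hat_modelOp_two_pow, hat_uvec, hat_zero]
    rcases Nat.eq_zero_or_pos k with rfl | hk
    · rw [Finset.prod_eq_zero (i := p - 2) (Finset.mem_range.2 (by omega)), zero_mul]
      rw [Nat.zero_add, Nat.cast_sub (by omega)]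
      simp
    · rw [if_neg (by omega), mul_zero]

/-- In height one `χ (e_0) ≠ 0`, so no weight lies in the prime field. -/
theorem apply_e_zero_ne_zero_of_height [Fact p.Prime]
    {χ : Module.Dual K (WittAlgebra K p)} (h : height χ = 1) :
    χ (e K p 0) ≠ 0 := by
  intro h0
  have hmem : (0 : ℤ) ∈ {i : ℤ | -1 ≤ i ∧ i ≤ (p : ℤ) - 1 ∧ ∀ x ∈ filt K p i, χ x = 0} :=
    ⟨by omega, by have := (Fact.out : p.Prime).one_lt; omega, fun x hx => by
      rw [apply_eq_of_height_le_one h.le hx, h0, mul_zero]⟩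
  have : height χ ≤ 0 := csInf_le ⟨-1, fun i hi => hi.1⟩ hmem
  omega

theorem extOp_one_pow {l : K} {c : ℕ → K} (h : IsExtData p l c) (t : K) (j : ℕ)
    (x : Fin p → K) (s : K) :
    (extOp c t l 1 ^ j) (x, s) = ((modelOp t l 1 ^ j) x, l ^ j * s) := by
  induction j with
  | zero => simp
  | succ j ih =>
    rw [pow_succ', Module.End.mul_apply, ih, extOp_apply, extVec_one h, if_pos rfl, smul_zero,
      add_zero, pow_succ', pow_succ', Module.End.mul_apply, mul_assoc]

section

variable [CharP K p] {l : K} {c : ℕ → K}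

theorem extOp_eq_zero [Fact p.Prime] (h : IsExtData p l c) (t : K) {m : ℕ} (hm : p ≤ m) :
    extOp (p := p) c t l m = 0 := by
  have hp := (Fact.out : p.Prime).one_lt
  have hv : extVec p c m = 0 := hat_ext fun k => by
    rw [hat_extVec, hat_zero]
    split_ifs with hk
    · rcases (by omega : m = p ∨ m = p + 1) with rfl | rfl
      · exact h.apply_p
      · exact h.apply_p_succ
    · rfl
  refine LinearMap.ext fun x => ?_
  obtain ⟨x, s⟩ := x
  rw [extOp_apply, modelOp_eq_zero t l hm, hv, if_neg (by omega)]
  simp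

theorem modelOp_extVec_sub (h : IsExtData p l c) (t : K) {m n : ℕ} (hm : 2 ≤ m) (hn : 2 ≤ n) :
    modelOp t l m (extVec p c n) - modelOp t l n (extVec p c m) =
      ((n : K) - m) • extVec p c (m + n - 1) := by
  refine hat_ext fun k => ?_
  rw [hat_sub, hat_smul, hat_modelOp_of_pos _ _ (by omega), hat_modelOp_of_pos _ _ (by omega),
    hat_extVec, hat_extVec, hat_extVec]
  by_cases hk : k + m + n = p + 2
  · rw [if_pos (by omega), if_pos (by omega), if_pos (by omega), ← h.cocycle m n hm hn]
    have h0 : ((k + m + n : ℕ) : K) = ((p + 2 : ℕ) : K) := congrArg _ hk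
    push_cast at h0
    rw [CharP.cast_eq_zero K p, zero_add] at h0
    linear_combination (c m - c n) * h0
  · rw [if_neg (by omega), if_neg (by omega), if_neg (by omega)]
    ring

theorem modelOp_one_extVec (t : K) (m : ℕ) :
    modelOp t l 1 (extVec p c m) = (l + m - 1) • extVec p c m := by
  refine hat_ext fun k => ?_
  rw [hat_smul, hat_modelOp_of_pos _ _ le_rfl, Nat.add_sub_cancel, hat_extVec]
  split_ifs with hk
  · have h0 : ((k + m : ℕ) : K) = ((p + 1 : ℕ) : K) := congrArg _ hk.1
    push_cast at h0
    rw [CharP.cast_eq_zero K p, zero_add] at h0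
    push_cast
    linear_combination -c m * h0
  · ring

theorem extOp_lie (h : IsExtData p l c) (t : K) (m n : ℕ) (hm : 1 ≤ m) (hn : 1 ≤ n) :
    extOp (p := p) c t l m * extOp c t l n - extOp c t l n * extOp c t l m =
      ((n : K) - m) • extOp c t l (m + n - 1) := by
  refine LinearMap.ext fun x => ?_
  obtain ⟨x, s⟩ := x
  have hmod := LinearMap.congr_fun (modelOp_lie_pos (p := p) t l hm hn) x
  rw [LinearMap.sub_apply, Module.End.mul_apply, Module.End.mul_apply, LinearMap.smul_apply,
    sub_eq_iff_eq_add] at hmod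
  rw [LinearMap.sub_apply, Module.End.mul_apply, Module.End.mul_apply, LinearMap.smul_apply]
  simp only [extOp_apply]
  refine Prod.ext ?_ ?_
  · simp only [Prod.fst_sub, Prod.smul_fst, map_add, map_smul, smul_add]
    rw [hmod]
    rcases (by omega : m = 1 ∨ 2 ≤ m) with rfl | hm2
    · rcases (by omega : n = 1 ∨ 2 ≤ n) with rfl | hn2
      · simp [extVec_one h]
      · rw [if_pos rfl, if_neg (by omega), extVec_one h, modelOp_one_extVec,
          show 1 + n - 1 = n by omega]
        simp only [map_zero, smul_zero]
        push_cast
        module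
    · rcases (by omega : n = 1 ∨ 2 ≤ n) with rfl | hn2
      · rw [if_pos rfl, if_neg (by omega), extVec_one h, modelOp_one_extVec,
          show m + 1 - 1 = m by omega]
        simp only [map_zero, smul_zero]
        push_cast
        module
      · rw [if_neg (by omega), if_neg (by omega), smul_comm _ s, ← modelOp_extVec_sub h t hm2 hn2]
        module
  · simp only [Prod.snd_sub, Prod.smul_snd, smul_eq_mul]
    by_cases h1 : m = 1 ∧ n = 1
    · obtain ⟨rfl, rfl⟩ := h1
      simp
    · rw [if_neg (show ¬ (m + n - 1 = 1) by omega)]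
      rcases (by omega : m ≠ 1 ∨ n ≠ 1) with h2 | h2
      · simp [h2]
      · simp [h2]

theorem extOp_one_pow_p [Fact p.Prime] (h : IsExtData p l c) (t : K) :
    extOp (p := p) c t l 1 ^ p - extOp c t l 1 = algebraMap K _ (l ^ p - l) := by
  refine LinearMap.ext fun x => ?_
  obtain ⟨x, s⟩ := x
  have hmod := LinearMap.congr_fun (modelOp_one_pow_p (p := p) t l) x
  rw [Module.algebraMap_end_apply, LinearMap.sub_apply] at hmod
  rw [Module.algebraMap_end_apply, LinearMap.sub_apply, extOp_one_pow h, extOp_apply, extVec_one h,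
    if_pos rfl, smul_zero, add_zero, Prod.mk_sub_mk, hmod, Prod.smul_mk, smul_eq_mul]
  congr 1
  ring

theorem extOp_pow_p [Fact p.Prime] (h : IsExtData p l c) (t : K) {m : ℕ} (hm : 2 ≤ m) :
    extOp (p := p) c t l m ^ p = 0 := by
  have hp := (Fact.out : p.Prime).two_le
  have hpow : ∀ j (x : Fin p → K),
      (extOp c t l m ^ j) (x, (0 : K)) = ((modelOp t l m ^ j) x, 0) := fun j x => by
    induction j with
    | zero => simp
    | succ j ih =>
      rw [pow_succ', Module.End.mul_apply, ih, extOp_apply, if_neg (by omega), zero_smul, add_zero,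
        pow_succ', Module.End.mul_apply]
  have hvec : (modelOp t l m ^ (p - 1)) (extVec p c m) = 0 := by
    rcases (by omega : m = 2 ∨ 3 ≤ m) with rfl | hm3
    · have : extVec p c 2 = c 2 • uvec K p (p - 1) := hat_ext fun k => by
        rw [hat_extVec, hat_smul, hat_uvec, mul_ite, mul_one, mul_zero]
        exact if_congr (by omega) rfl rfl
      rw [this, map_smul, h.pow_eq_zero, smul_zero]
    · refine hat_ext fun k => ?_
      obtain ⟨d, hd⟩ := exists_hat_modelOp_pow (p := p) t l (show 1 ≤ m by omega) (p - 1) k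
      have : (p - 1) * 2 ≤ (p - 1) * (m - 1) := Nat.mul_le_mul_left _ (by omega)
      rw [hd, hat_of_le _ (by omega), hat_zero, mul_zero]
  refine LinearMap.ext fun x => ?_
  obtain ⟨x, s⟩ := x
  have hmod := LinearMap.congr_fun (modelOp_pow_p (p := p) t l hm) x
  obtain ⟨q, rfl⟩ : ∃ q, p = q + 1 := ⟨p - 1, by omega⟩
  rw [pow_succ, Module.End.mul_apply] at hmod
  rw [pow_succ, Module.End.mul_apply, extOp_apply, if_neg (by omega), hpow, map_add, map_smul, hmod]
  rw [Nat.add_sub_cancel] at hvec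
  rw [hvec]
  simp

variable [Fact p.Prime]

/-- The extension module. -/
def extRep (hp : 3 < p) (χ : Module.Dual K (WittAlgebra K p)) (hχ : height χ ≤ 1)
    (hl : l ∈ weights χ) (h : IsExtData p l c) :
    UW0 χ →ₐ[K] Module.End K ((Fin p → K) × K) :=
  ReducedEnveloping.lift p (pMap0 K p) (χ.comp (W0 K p).toSubmodule.subtype)
    (lieHomOfFamily0 (fun _ => extOp_eq_zero h (χ (e K p (-1)) ^ p)) (extOp_lie h _)) <| by
    refine reducedRel_of_span (isPMap_pMap0 K p) _ _ (span_range_e0 K p) ?_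
    rintro _ ⟨i, rfl⟩
    rw [pMap0_e0 hp, lieHomOfFamily0_e0]
    change _ = algebraMap K _ (χ (e K p (i : ℤ)) ^ p)
    rcases Nat.eq_zero_or_pos i with rfl | hi
    · rw [if_pos rfl, lieHomOfFamily0_e0, extOp_one_pow_p h, show l ^ p - l = _ from hl]
      rfl
    · have h1 := apply_e_of_height_le_one hχ (m := i + 1) (by omega)
      rw [show ((i + 1 : ℕ) : ℤ) - 1 = i by push_cast; ring] at h1
      rw [if_neg (by omega), map_zero, extOp_pow_p h _ (by omega), h1,
        zero_pow (Fact.out : p.Prime).ne_zero, map_zero, sub_zero]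

theorem extRep_eW0 (hp : 3 < p) (χ : Module.Dual K (WittAlgebra K p)) (hχ : height χ ≤ 1)
    (hl : l ∈ weights χ) (h : IsExtData p l c) (i : ℕ) :
    extRep hp χ hχ hl h (eW0 χ i) = extOp c (χ (e K p (-1)) ^ p) l (i + 1) := by
  rw [extRep, eW0, ReducedEnveloping.lift_ι, lieHomOfFamily0_e0]

theorem extRep_apply (hp : 3 < p) (χ : Module.Dual K (WittAlgebra K p)) (hχ : height χ ≤ 1)
    (hl : l ∈ weights χ) (h : IsExtData p l c) (a : UW0 χ) :
    (∀ x, extRep hp χ hχ hl h a (x, 0) = (modelRep hp χ hχ l hl (incl χ a) x, 0)) ∧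
      ∀ z, (extRep hp χ hχ hl h a z).2 = character χ hχ l hl a * z.2 := by
  induction a using ReducedEnveloping.induction (span_range_e0 K p) with
  | halg r =>
    refine ⟨fun x => ?_, fun z => ?_⟩
    · rw [AlgHom.commutes, modelRep_incl_algebraMap, Module.algebraMap_end_apply, Prod.smul_mk,
        smul_zero]
    · rw [AlgHom.commutes, AlgHom.commutes, Module.algebraMap_end_apply]
      rfl
  | hadd a b ha hb =>
    refine ⟨fun x => ?_, fun z => ?_⟩
    · rw [map_add, map_add, map_add, LinearMap.add_apply, LinearMap.add_apply, ha.1, hb.1,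
        Prod.mk_add_mk, add_zero]
    · rw [map_add, map_add, LinearMap.add_apply, Prod.snd_add, ha.2, hb.2, add_mul]
  | hmul a b ha hb =>
    refine ⟨fun x => ?_, fun z => ?_⟩
    · rw [map_mul, map_mul, map_mul, Module.End.mul_apply, Module.End.mul_apply, hb.1, ha.1]
    · rw [map_mul, map_mul, Module.End.mul_apply, ha.2, hb.2, mul_assoc]
  | hι x hx =>
    obtain ⟨i, rfl⟩ := hx
    change (∀ x, extRep hp χ hχ hl h (eW0 χ i) (x, 0) =
      (modelRep hp χ hχ l hl (incl χ (eW0 χ i)) x, 0)) ∧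
      ∀ z, (extRep hp χ hχ hl h (eW0 χ i) z).2 = character χ hχ l hl (eW0 χ i) * z.2
    rw [extRep_eW0, modelRep_incl_eW0, character_eW0]
    refine ⟨fun x => ?_, fun z => ?_⟩
    · rw [extOp_apply, zero_smul, add_zero, mul_zero, ite_self]
    · obtain ⟨x, s⟩ := z
      rw [extOp_apply]
      by_cases hi : i = 0 <;> simp [hi]

/-- The cocycle `x ↦ x w` of the extension module. -/
theorem IsExtData.exists_modelCocycle (hp : 3 < p) (χ : Module.Dual K (WittAlgebra K p))
    (hχ : height χ ≤ 1) (hl : l ∈ weights χ) (h : IsExtData p l c) (h2 : c 2 ≠ 0) :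
    ∃ φ : ModelCocycle hp χ hχ l hl, φ.coeff 1 ≠ 0 := by
  refine ⟨{ toFun := {
              toFun := fun x => (extRep hp χ hχ hl h x (0, 1)).1
              map_zero' := by simp
              map_add' := fun x y => by simp }
            map_smul := fun a x => ?_ }, ?_⟩
  · have hx : extRep hp χ hχ hl h x (0, 1) = ((extRep hp χ hχ hl h x (0, 1)).1, 0) :=
      Prod.ext rfl (by rw [(extRep_apply hp χ hχ hl h _).2, mem_ker_oneDimPres.1 x.2, zero_mul])
    change (extRep hp χ hχ hl h (a * x) (0, 1)).1 = _
    rw [map_mul, Module.End.mul_apply, hx, (extRep_apply hp χ hχ hl h a).1]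
    rfl
  · change hat (extRep hp χ hχ hl h (augGen hχ hl 1) (0, 1)).1 (p - 1) ≠ 0
    rw [coe_augGen le_rfl, extRep_eW0, extOp_apply]
    simp only
    rw [map_zero, zero_add, one_smul, hat_extVec, if_pos (by omega)]
    exact h2

theorem exists_modelCocycle (hp : 3 < p) (χ : Module.Dual K (WittAlgebra K p))
    (hχ : height χ ≤ 1) (hl : l ∈ weights χ) (h : l = 0 ∨ l = -1) :
    ∃ φ : ModelCocycle hp χ hχ l hl, φ.coeff 1 ≠ 0 := by
  rcases h with rfl | rfl
  · refine (isExtData_zero hp).exists_modelCocycle hp χ hχ hl ?_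
    have := natCast_ne_zero_of_lt (K := K) (p := p) (n := 2) (by omega) (by omega)
    intro h'
    push_cast at this h'
    exact this (by linear_combination h')
  · exact (isExtData_neg_one hp).exists_modelCocycle hp χ hχ hl (by simp)

end

end WittAlgebra

end

/-! ### The computation of `Ext¹` -/

open WittAlgebra in
/-- The functional sending a cocycle to its coefficient at `e_1` vanishes exactly on the
coboundaries, and it is nonzero exactly for `l = 0` and `l = -1`. -/
theorem WittAlgebra.ext_one_vermaRes {K : Type u} [Field K] {p : ℕ} [Fact p.Prime] [CharP K p]
    (hp : 3 < p) (χ : Module.Dual K (WittAlgebra K p)) (hχ : height χ ≤ 1) (l : K)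
    (hl : l ∈ weights χ) :
    ((l = 0 ∨ l = -1) →
      Nonempty (Abelian.Ext (oneDim χ hχ l hl) (vermaRes χ hχ l hl) 1 ≃ₗ[K] K)) ∧
    (¬ (l = 0 ∨ l = -1) →
      Subsingleton (Abelian.Ext (oneDim χ hχ l hl) (vermaRes χ hχ l hl) 1)) := by
  obtain ⟨f, hf⟩ := exists_verma_equiv hp χ hχ l hl
  let g : vermaRes χ hχ l hl ≃+ (Fin p → K) := f
  have hg : ∀ (a : UW0 χ) v, g (a • v) = modelRep hp χ hχ l hl (incl χ a) (g v) :=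
    fun a v => hf (incl χ a) v
  let toCocycle : (LinearMap.ker (oneDimPres χ hχ l hl) →ₗ[UW0 χ] vermaRes χ hχ l hl) →
      ModelCocycle hp χ hχ l hl := fun φ =>
    { toFun := g.toAddMonoidHom.comp φ.toAddMonoidHom
      map_smul := fun a x => (congrArg g (φ.map_smul a x)).trans (hg a _) }
  have hcob : ∀ φ, (toCocycle φ).coeff 1 = 0 →
      ∃ n : vermaRes χ hχ l hl, ∀ x, φ x = (x : UW0 χ) • n := fun φ h => by
    obtain ⟨v, hv⟩ := (toCocycle φ).exists_eq_coboundary h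
    refine ⟨g.symm v, fun x => g.injective ?_⟩
    rw [hg, g.apply_symm_apply]
    exact hv x
  refine ⟨fun h => ?_, fun h => ?_⟩
  · let F : vermaRes χ hχ l hl →+ K :=
      { toFun := fun v => hat (g v) (p - 1)
        map_zero' := by rw [map_zero, hat_zero]
        map_add' := fun v w => by rw [map_add, hat_add] }
    refine nonempty_ext_one_equiv oneDimPres_surjective _ F (fun r v => ?_) (augGen hχ hl 1)
      hcob (fun v => ?_) ?_
    · change hat (g (algebraMap K (UW0 χ) r • v)) (p - 1) = r * hat (g v) (p - 1)
      rw [hg, modelRep_incl_algebraMap, hat_smul]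
    · change hat (g ((augGen hχ hl 1 : UW0 χ) • v)) (p - 1) = 0
      rw [hg, ModelCocycle.coboundary_coeff_one]
    · obtain ⟨φ, hφ⟩ := exists_modelCocycle hp χ hχ hl h
      refine ⟨{ toFun := fun x => g.symm (φ.toFun x)
                map_add' := fun x y => by rw [map_add, map_add]
                map_smul' := fun a x => g.injective ?_ }, ?_⟩
      · rw [RingHom.id_apply, hg, g.apply_symm_apply, g.apply_symm_apply, φ.map_smul]
      · change hat (g (g.symm (φ.toFun (augGen hχ hl 1)))) (p - 1) ≠ 0
        rw [g.apply_symm_apply]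
        exact hφ
  · refine subsingleton_ext_one K oneDimPres_surjective _ fun φ => hcob φ ?_
    refine (toCocycle φ).coeff_one_eq_zero (fun h0 => h (Or.inl h0)) fun h1 => h (Or.inr ?_)
    exact eq_neg_of_add_eq_zero_left h1

theorem mainTheorem2 {K : Type u} [Field K] [IsAlgClosed K] (p : ℕ) [Fact p.Prime] [CharP K p]
    (hp : 3 < p) (χ : Module.Dual K (WittAlgebra K p)) (hχ : WittAlgebra.height χ ≤ 1)
    (l : K) (hl : l ∈ WittAlgebra.weights χ) :
    ((l = 0 ∨ l = ((p - 1 : ℕ) : K)) →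
      Nonempty (Abelian.Ext (WittAlgebra.oneDim χ hχ l hl) (WittAlgebra.vermaRes χ hχ l hl) 1
        ≃ₗ[K] K)) ∧
    (¬ (l = 0 ∨ l = ((p - 1 : ℕ) : K)) →
      Subsingleton
        (Abelian.Ext (WittAlgebra.oneDim χ hχ l hl) (WittAlgebra.vermaRes χ hχ l hl) 1)) ∧
    (WittAlgebra.height χ = 1 →
      Subsingleton
        (Abelian.Ext (WittAlgebra.oneDim χ hχ l hl) (WittAlgebra.vermaRes χ hχ l hl) 1)) := by
  have hcast : ((p - 1 : ℕ) : K) = -1 := by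
    rw [Nat.cast_sub (by omega), CharP.cast_eq_zero, Nat.cast_one, zero_sub]
  rw [hcast]
  obtain ⟨h1, h2⟩ := WittAlgebra.ext_one_vermaRes hp χ hχ l hl
  refine ⟨h1, h2, fun hχ1 => h2 fun h => ?_⟩
  -- for `l` in the prime field `l ^ p - l` vanishes, whereas `χ (e_0)` does not
  have h0 : l ^ p - l = 0 := by
    rcases h with rfl | rfl
    · rw [zero_pow (by omega), sub_zero]
    · rw [neg_one_pow_char, sub_self]
  have hw : l ^ p - l = χ (WittAlgebra.e K p 0) ^ p := hl
  exact WittAlgebra.apply_e_zero_ne_zero_of_height hχ1 (pow_eq_zero_iff (by omega) |>.1 (hw ▸ h0))
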